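/- Let $m\ge 0$, let $U\subset\mathbf R^2\times\mathbf R^{3m}$ be open with coordinates $(x,y,u^\gamma,u^\gamma_x,u^\gamma_y)$, and let $f^\alpha\in C^\infty(U)$, $\alpha=1,\dots,m$, be such that on $U$ the system $u^\alpha_{xy}=f^\alpha(x,y,u,u_x,u_y)$ has the form $$u^\alpha_{xy}+C^\alpha_{\beta\gamma}u^\beta_xu^\gamma_y+A^\alpha_\gamma u^\gamma_x+B^\alpha_\gamma u^\gamma_y+E^\alpha=0$$ with coefficients depending only on $(x,y,u)$ (summation over repeated indices). Put $$H^\gamma_\alpha=\frac{\partial f^\gamma}{\partial u^\alpha}+\frac{\partial f^\gamma}{\partial u^\sigma_y}\frac{\partial f^\sigma}{\partial u^\alpha_x}-D_x\frac{\partial f^\gamma}{\partial u^\alpha_x},\qquad K^\gamma_\alpha=\frac{\partial f^\gamma}{\partial u^\alpha}+\frac{\partial f^\gamma}{\partial u^\sigma_x}\frac{\partial f^\sigma}{\partial u^\alpha_y}-D_y\frac{\partial f^\gamma}{\partial u^\alpha_y},\qquad S^\gamma_{\alpha\beta}=\frac{\partial^2f^\gamma}{\partial u^\beta_x\partial u^\alpha_y}-\frac{\partial^2f^\gamma}{\partial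 u^\alpha_x\partial u^\beta_y},$$ where $D_x,D_y$ are the total derivatives with $u^\beta_{xy}$ replaced by $f^\beta$, and $\Omega^\sigma_\alpha=C^\sigma_{\alpha\tau}du^\tau+A^\sigma_\alpha dy+B^\sigma_\alpha dx$. The multiplier conditions on a symmetric matrix $M_{\alpha\beta}$ of smooth functions of $(x,y,u)$ are $$M_{\alpha\sigma}H^\sigma_\beta=M_{\beta\sigma}K^\sigma_\alpha,\qquad M_{\alpha\sigma}S^\sigma_{\beta\gamma}=-M_{\beta\sigma}S^\sigma_{\alpha\gamma},\qquad dM_{\alpha\beta}=M_{\alpha\sigma}\Omega^\sigma_\beta+M_{\beta\sigma}\Omega^\sigma_\alpha.\tag{EMcon}$$ For $W\subset U$, a solution over $W$ is such an $M$, defined on the projection of $W$ to $(x,y,u)$-space, that satisfies (EMcon) at all points of $W$. Define matrices $\Phi_k(z)$, $z\in U$, $k=0,1,2,\dots$, with $m(m+1)/2$ columns, acting on symmetric matrices, as follows. The equations $\Phi_0M=0$ are the two algebraic conditions, the first one split into its coefficients as a polynomial in $(u_x,u_y)$ (which is done by adjoining its derivatives by $\partial_{u_x^\sigma}$, $\partial_{u_y^\tau}$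 and $\partial_{u_x^\sigma}\partial_{u_y^\tau}$). $\Phi_{k+1}$ consists of the rows of $\Phi_k$ and of the rows obtained by differentiating $\Phi_kM=0$ with respect to $x$, $y$ and each $u^\tau$ and substituting for $dM$ from (EMcon). Then $\operatorname{rank}\Phi_k(z)\le\operatorname{rank}\Phi_{k+1}(z)$ and $\operatorname{rank}\Phi_k(z)\le m(m+1)/2$ for all $z\in U$ and all $k$. Let $V\subset U$ be open, and suppose that $\operatorname{rank}\Phi_k(z)=r$ for all $z\in V$, where either $k\ge m(m+1)/2$, or the rank has stabilized on $V$ in the sense that also $\operatorname{rank}\Phi_{k+1}(z)=r$ for all $z\in V$. Then $\operatorname{rank}\Phi_{k+i}(z)=r$ for all $i\ge0$ and $z\in V$, and every $z_0\in V$ has a connected open neighborhood $W\subset V$ such that the solutions of (EMcon) over $W$ form a real vector space of dimension $m(m+1)/2-r$. In particular this holds with the single matrix $\Phi=\Phi_{m(m+1)/2}$ whenever its rank is constant on $V$. -/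

import Mathlib

open scoped ContDiff

noncomputable section

namespace VarMult

/-- The space of the variables `(x, y, u)`. -/
abbrev Base (m : ℕ) : Type := ℝ × ℝ × (Fin m → ℝ)

/-- The space of the variables `((x, y, u), (u_x, u_y))`, that is `ℝ² × ℝ³ᵐ`. -/
abbrev Jet (m : ℕ) : Type := Base m × (Fin m → ℝ) × (Fin m → ℝ)

variable {m : ℕ}

/-! Coordinate vectors of the jet space. -/

/-- `∂/∂x` -/
def eX : Jet m := ((1, 0, 0), 0, 0)
/-- `∂/∂y` -/
def eY : Jet m := ((0, 1, 0), 0, 0)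
/-- `∂/∂u^α` -/
def eU (α : Fin m) : Jet m := ((0, 0, Pi.single α 1), 0, 0)
/-- `∂/∂u_x^α` -/
def eP (α : Fin m) : Jet m := ((0, 0, 0), Pi.single α 1, 0)
/-- `∂/∂u_y^α` -/
def eQ (α : Fin m) : Jet m := ((0, 0, 0), 0, Pi.single α 1)

/-- Partial derivative of `g` along the (constant) vector `v`. -/
def pd (v : Jet m) (g : Jet m → ℝ) : Jet m → ℝ := fun j => fderiv ℝ g j v

/-! The invariants of the system `u^α_{xy} = f^α(x, y, u, u_x, u_y)`. The upper index comes first. -/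

/-- `H^γ_α` at the jet `j`; the argument `uxx` is the value of `u_{xx}`. -/
def H (f : Fin m → Jet m → ℝ) (γ α : Fin m) (j : Jet m) (uxx : Fin m → ℝ) : ℝ :=
  pd (eU α) (f γ) j
    + ∑ σ, pd (eQ σ) (f γ) j * pd (eP α) (f σ) j
    - pd eX (pd (eP α) (f γ)) j
    - ∑ β, pd (eU β) (pd (eP α) (f γ)) j * j.2.1 β
    - ∑ β, pd (eQ β) (pd (eP α) (f γ)) j * f β j
    - ∑ β, pd (eP β) (pd (eP α) (f γ)) j * uxx β

/-- `K^γ_α` at the jet `j`; the argument `uyy` is the value of `u_{yy}`. -/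
def K (f : Fin m → Jet m → ℝ) (γ α : Fin m) (j : Jet m) (uyy : Fin m → ℝ) : ℝ :=
  pd (eU α) (f γ) j
    + ∑ σ, pd (eP σ) (f γ) j * pd (eQ α) (f σ) j
    - pd eY (pd (eQ α) (f γ)) j
    - ∑ β, pd (eU β) (pd (eQ α) (f γ)) j * j.2.2 β
    - ∑ β, pd (eP β) (pd (eQ α) (f γ)) j * f β j
    - ∑ β, pd (eQ β) (pd (eQ α) (f γ)) j * uyy β

/-- `S^γ_{αβ} = ∂²f^γ/∂u_x^β ∂u_y^α - ∂²f^γ/∂u_x^α ∂u_y^β`. -/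
def S (f : Fin m → Jet m → ℝ) (γ α β : Fin m) (j : Jet m) : ℝ :=
  pd (eP β) (pd (eQ α) (f γ)) j - pd (eP α) (pd (eQ β) (f γ)) j

/-- Coefficients of a normal form; `C α β γ = C^α_{βγ}`, `A α γ = A^α_γ`, `B α γ = B^α_γ`. -/
structure Coeffs (m : ℕ) where
  C : Fin m → Fin m → Fin m → Base m → ℝ
  A : Fin m → Fin m → Base m → ℝ
  B : Fin m → Fin m → Base m → ℝ
  E : Fin m → Base m → ℝ

/-- On `U` the system `u^α_{xy} = f^α` reads
`u^α_{xy} + C^α_{βγ} u^β_x u^γ_y + A^α_γ u^γ_x + B^α_γ u^γ_y + E^α = 0`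
with coefficients depending only on `(x, y, u)`. -/
def HasNormalForm (f : Fin m → Jet m → ℝ) (c : Coeffs m) (U : Set (Jet m)) : Prop :=
  ∀ j ∈ U, ∀ α : Fin m,
    f α j + ∑ β, ∑ γ, c.C α β γ j.1 * j.2.1 β * j.2.2 γ
      + ∑ γ, c.A α γ j.1 * j.2.1 γ + ∑ γ, c.B α γ j.1 * j.2.2 γ + c.E α j.1 = 0

/-! The coordinate 1-forms on the space of `(x, y, u)`. -/

def dx : Base m →L[ℝ] ℝ := ContinuousLinearMap.fst ℝ ℝ (ℝ × (Fin m → ℝ))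

def dy : Base m →L[ℝ] ℝ :=
  (ContinuousLinearMap.fst ℝ ℝ (Fin m → ℝ)).comp
    (ContinuousLinearMap.snd ℝ ℝ (ℝ × (Fin m → ℝ)))

def du (τ : Fin m) : Base m →L[ℝ] ℝ :=
  (ContinuousLinearMap.proj (R := ℝ) (φ := fun _ : Fin m => ℝ) τ).comp
    ((ContinuousLinearMap.snd ℝ ℝ (Fin m → ℝ)).comp
      (ContinuousLinearMap.snd ℝ ℝ (ℝ × (Fin m → ℝ))))

/-- `Ω^σ_α = C^σ_{ατ} du^τ + A^σ_α dy + B^σ_α dx` at the point `z`. -/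
def Omega (c : Coeffs m) (σ α : Fin m) (z : Base m) : Base m →L[ℝ] ℝ :=
  ∑ τ, c.C σ α τ z • du τ + c.A σ α z • dy + c.B σ α z • dx

/-! A symmetric matrix `M_{αβ}` is a vector indexed by the unordered pairs of indices
(there are `m(m+1)/2` of them); its entries are `M s(α, β)`. -/

/-- The 1-form `M_{ασ} Ω^σ_β + M_{βσ} Ω^σ_α` at the point `z`. -/
def connForm (c : Coeffs m) (z : Base m) (M : Sym2 (Fin m) → ℝ) (α β : Fin m) :
    Base m →L[ℝ] ℝ :=
  ∑ σ, (M s(α, σ) • Omega c σ β z + M s(β, σ) • Omega c σ α z)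

theorem connForm_comm (c : Coeffs m) (z : Base m) (M : Sym2 (Fin m) → ℝ) (α β : Fin m) :
    connForm c z M α β = connForm c z M β α := by
  unfold connForm
  exact Finset.sum_congr rfl fun σ _ => add_comm _ _

/-- The symmetric matrix `(M_{ασ} Ω^σ_β + M_{βσ} Ω^σ_α)(v)`. -/
def connAct (c : Coeffs m) (z v : Base m) (M : Sym2 (Fin m) → ℝ) : Sym2 (Fin m) → ℝ :=
  Sym2.lift ⟨fun α β => connForm c z M α β v, fun α β => congrArg (fun L => L v) (connForm_comm c z M α β)⟩

/-- The difference of the two sides of `M_{ασ} H^σ_β = M_{βσ} K^σ_α`. -/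
def algHK (f : Fin m → Jet m → ℝ) (M : Sym2 (Fin m) → ℝ) (α β : Fin m) (j : Jet m)
    (uxx uyy : Fin m → ℝ) : ℝ :=
  ∑ σ, M s(α, σ) * H f σ β j uxx - ∑ σ, M s(β, σ) * K f σ α j uyy

/-- The difference of the two sides of `M_{ασ} S^σ_{βγ} = - M_{βσ} S^σ_{αγ}`. -/
def algS (f : Fin m → Jet m → ℝ) (M : Sym2 (Fin m) → ℝ) (α β γ : Fin m) (j : Jet m) : ℝ :=
  ∑ σ, M s(α, σ) * S f σ β γ j + ∑ σ, M s(β, σ) * S f σ α γ j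

/-- `M`, a symmetric matrix of smooth functions of `(x, y, u)` defined on the projection of `W`,
satisfies the algebraic and the differential multiplier conditions at all points of `W`. -/
structure IsMultiplierSolution (f : Fin m → Jet m → ℝ) (c : Coeffs m) (W : Set (Jet m))
    (M : Base m → Sym2 (Fin m) → ℝ) : Prop where
  smooth : ContDiffOn ℝ ∞ M (Prod.fst '' W)
  alg_HK : ∀ j ∈ W, ∀ α β : Fin m, ∀ uxx uyy : Fin m → ℝ, algHK f (M j.1) α β j uxx uyy = 0
  alg_S : ∀ j ∈ W, ∀ α β γ : Fin m, algS f (M j.1) α β γ j = 0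
  diff : ∀ z ∈ Prod.fst '' W, ∀ α β : Fin m,
    HasFDerivAt (fun z' => M z' s(α, β)) (connForm c z (M z) α β) z

theorem algHK_add (f : Fin m → Jet m → ℝ) (M N : Sym2 (Fin m) → ℝ) (α β : Fin m) (j : Jet m)
    (a b : Fin m → ℝ) :
    algHK f (M + N) α β j a b = algHK f M α β j a b + algHK f N α β j a b := by
  simp only [algHK, Pi.add_apply, add_mul, Finset.sum_add_distrib]; ring

theorem algHK_smul (f : Fin m → Jet m → ℝ) (t : ℝ) (M : Sym2 (Fin m) → ℝ) (α β : Fin m)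
    (j : Jet m) (a b : Fin m → ℝ) :
    algHK f (t • M) α β j a b = t * algHK f M α β j a b := by
  simp only [algHK, Pi.smul_apply, smul_eq_mul, mul_assoc, ← Finset.mul_sum]; ring

theorem algS_add (f : Fin m → Jet m → ℝ) (M N : Sym2 (Fin m) → ℝ) (α β γ : Fin m) (j : Jet m) :
    algS f (M + N) α β γ j = algS f M α β γ j + algS f N α β γ j := by
  simp only [algS, Pi.add_apply, add_mul, Finset.sum_add_distrib]; ring

theorem algS_smul (f : Fin m → Jet m → ℝ) (t : ℝ) (M : Sym2 (Fin m) → ℝ) (α β γ : Fin m)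
    (j : Jet m) : algS f (t • M) α β γ j = t * algS f M α β γ j := by
  simp only [algS, Pi.smul_apply, smul_eq_mul, mul_assoc, ← Finset.mul_sum]; ring

theorem connForm_add (c : Coeffs m) (z : Base m) (M N : Sym2 (Fin m) → ℝ) (α β : Fin m) :
    connForm c z (M + N) α β = connForm c z M α β + connForm c z N α β := by
  simp only [connForm, Pi.add_apply, ← Finset.sum_add_distrib]
  refine Finset.sum_congr rfl fun σ _ => ?_
  module

theorem connForm_smul (c : Coeffs m) (z : Base m) (t : ℝ) (M : Sym2 (Fin m) → ℝ)
    (α β : Fin m) : connForm c z (t • M) α β = t • connForm c z M α β := by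
  simp only [connForm, Pi.smul_apply, Finset.smul_sum]
  refine Finset.sum_congr rfl fun σ _ => ?_
  module

/-- The real vector space of solutions of the multiplier conditions over `W`. A function on the
projection of `W` is represented by its extension by zero to all of `Base m`. -/
def solutionSpace (f : Fin m → Jet m → ℝ) (c : Coeffs m) (W : Set (Jet m)) :
    Submodule ℝ (Base m → Sym2 (Fin m) → ℝ) where
  carrier := {M | IsMultiplierSolution f c W M ∧ ∀ z ∉ Prod.fst '' W, M z = 0}
  zero_mem' := by
    refine ⟨⟨contDiffOn_const, ?_, ?_, ?_⟩, fun _ _ => rfl⟩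
    · intro j _ α β a b; simp [algHK]
    · intro j _ α β γ; simp [algS]
    · intro z _ α β
      have : connForm c z ((0 : Base m → Sym2 (Fin m) → ℝ) z) α β = 0 := by simp [connForm]
      rw [this]; exact hasFDerivAt_const (0 : ℝ) z
  add_mem' := by
    rintro M N ⟨hM, hM0⟩ ⟨hN, hN0⟩
    refine ⟨⟨hM.smooth.add hN.smooth, ?_, ?_, ?_⟩, ?_⟩
    · intro j hj α β a b
      simp only [Pi.add_apply M N, algHK_add, hM.alg_HK j hj, hN.alg_HK j hj, add_zero]
    · intro j hj α β γ
      simp only [Pi.add_apply M N, algS_add, hM.alg_S j hj, hN.alg_S j hj, add_zero]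
    · intro z hz α β
      rw [Pi.add_apply M N, connForm_add]
      exact (hM.diff z hz α β).add (hN.diff z hz α β)
    · intro z hz
      rw [Pi.add_apply, hM0 z hz, hN0 z hz, add_zero]
  smul_mem' := by
    rintro t M ⟨hM, hM0⟩
    refine ⟨⟨hM.smooth.const_smul t, ?_, ?_, ?_⟩, ?_⟩
    · intro j hj α β a b
      simp only [Pi.smul_apply t M, algHK_smul, hM.alg_HK j hj, mul_zero]
    · intro j hj α β γ
      simp only [Pi.smul_apply t M, algS_smul, hM.alg_S j hj, mul_zero]
    · intro z hz α β
      rw [Pi.smul_apply t M, connForm_smul]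
      exact (hM.diff z hz α β).const_smul t
    · intro z hz
      rw [Pi.smul_apply, hM0 z hz, smul_zero]

/-! The matrices `Φ_k`. -/

/-- Row labels of `Φ_0`. For a system in normal form `H` and `K` do not depend on `u_{xx}` and
`u_{yy}` and are polynomials in `(u_x, u_y)` of degree at most one in `u_x` and at most one in
`u_y`; hence the condition `M_{ασ} H^σ_β = M_{βσ} K^σ_α` together with its derivatives
`∂/∂u_x`, `∂/∂u_y`, `∂²/∂u_x∂u_y` at a single jet is, up to an invertible row operation, the system
of conditions obtained by equating all coefficients with respect to `(u_x, u_y)`. -/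
inductive AlgRow (m : ℕ) : Type
  | hk (α β : Fin m) : AlgRow m
  | hkP (α β σ : Fin m) : AlgRow m
  | hkQ (α β τ : Fin m) : AlgRow m
  | hkPQ (α β σ τ : Fin m) : AlgRow m
  | s (α β γ : Fin m) : AlgRow m

/-- The algebraic conditions, as linear expressions in a constant symmetric matrix `M`. -/
def algRowValue (f : Fin m → Jet m → ℝ) (M : Sym2 (Fin m) → ℝ) : AlgRow m → Jet m → ℝ
  | .hk α β => fun j => algHK f M α β j 0 0
  | .hkP α β σ => pd (eP σ) (fun j => algHK f M α β j 0 0)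
  | .hkQ α β τ => pd (eQ τ) (fun j => algHK f M α β j 0 0)
  | .hkPQ α β σ τ => pd (eP σ) (pd (eQ τ) (fun j => algHK f M α β j 0 0))
  | .s α β γ => algS f M α β γ

/-- The directions `∂/∂x`, `∂/∂y`, `∂/∂u^τ` in which conditions are differentiated. -/
inductive Dir (m : ℕ) : Type
  | x : Dir m
  | y : Dir m
  | u (τ : Fin m) : Dir m

def Dir.vec : Dir m → Base m
  | .x => (1, 0, 0)
  | .y => (0, 1, 0)
  | .u τ => (0, 0, Pi.single τ 1)

/-- Row labels of `Φ_k`: those of `Φ_{k+1}` are those of `Φ_k` and one more for each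
row of `Φ_k` and each direction of differentiation. -/
def RowIdx (m : ℕ) : ℕ → Type
  | 0 => AlgRow m
  | k + 1 => RowIdx m k ⊕ (RowIdx m k × Dir m)

/-- The matrix `Φ_k` at a jet, with `m(m+1)/2` columns; it acts on symmetric matrices `M` by
`Φ_k *ᵥ M`. `Φ_0 *ᵥ M = 0` are the algebraic conditions. `Φ_{k+1}` consists of the rows `φ` of
`Φ_k` and of the rows obtained from `d(φ · M) = 0` by substituting
`dM_{αβ} = M_{ασ} Ω^σ_β + M_{βσ} Ω^σ_α`. -/
def Phi (f : Fin m → Jet m → ℝ) (c : Coeffs m) :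
    (k : ℕ) → Jet m → Matrix (RowIdx m k) (Sym2 (Fin m)) ℝ
  | 0 => fun j => Matrix.of fun a e => algRowValue f (Pi.single e 1) a j
  | k + 1 => fun j =>
      Matrix.fromRows (Phi f c k j)
        (Matrix.of fun (a : RowIdx m k × Dir m) e =>
          pd (a.2.vec, 0, 0) (fun j' => Phi f c k j' a.1 e) j
            + ∑ e', Phi f c k j a.1 e' * connAct c j.1 a.2.vec (Pi.single e 1) e')

end VarMult

end

/-! The differential condition says that `M` is parallel for a linear connection (`connMap`) on the
trivial bundle of symmetric matrices over `(x, y, u)`-space. The algebraic conditions confine `M` to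
the kernel of `Φ_0`, and the rows added in `Φ_{k+1}` are the covariant derivatives of the rows of
`Φ_k`. A solution therefore lies in the kernel of every `Φ_k`. Conversely, where `Φ_k` and `Φ_{k+1}`
have the same constant rank, `ker Φ_k` is a subbundle preserved by parallel transport. If the
curvature annihilates it, each of its vectors at a point extends to a unique local parallel section,
so evaluation at that point identifies the solutions with a kernel of dimension `m(m+1)/2 - r`.

The curvature adds no further condition. Put `X = ∂/∂x + p^τ ∂/∂u^τ` and `Y = ∂/∂y + q^τ ∂/∂u^τ`.
Then `Ω(Y)` is `-∂f/∂u_x`, and `Ω(X)` is `-∂f/∂u_y` plus the contraction of `S` with `p`. Adding to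
the `H`-`K` condition its copy with the two indices exchanged gives `M(H - K) + (M(H - K))ᵀ = 0`.
Modulo the `S` condition and its covariant derivative along `Y`, this is the vanishing of the
curvature on `(Y, X)`. Since `p` and `q` are arbitrary, all curvature components vanish on `ker Φ_1`
(`curvature_eq_zero_of_rowMap_one`).

Stabilization: equal constant ranks give a local bound `‖Φ_{k+1} M‖ ≤ K ‖Φ_k M‖`
(`eventually_norm_le_of_ker_le`), and a zero to second order on the right forces one on the left
(`covDeriv_eq_zero_of_norm_le`), so the rank of `Φ_{k+2}` is again the same (`rank_Phi_add_two`). If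
only `k ≥ m(m+1)/2` is known, ranks growing strictly up to step `k` would already have reached the
number of columns (`rank_succ_eq_of_le`).

Parallel sections are obtained by solving the linear ODE along rays (`exists_flat_section`).
Gronwall's inequality keeps them in the kernel and, the curvature being zero there, also yields
their derivative in every direction.

Throughout, `f` is replaced by the explicit expression `rhs c`, and the fibre coordinates `(u_x,
u_y)` are frozen at one value `pq`. One jet suffices because the `H`-`K` condition is affine in
`u_x` and in `u_y` separately, and `S` does not involve them. -/

noncomputable section

namespace VarMult

open Filter Topology

/-! ### Families of linear maps: semicontinuity of the rank and constant rank -/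

section ConstantRank

variable {X F G G' : Type*} [TopologicalSpace X]
  [NormedAddCommGroup F] [NormedSpace ℝ F] [FiniteDimensional ℝ F]
  [NormedAddCommGroup G] [NormedSpace ℝ G] [NormedAddCommGroup G'] [NormedSpace ℝ G']

/-- On a complement `Q` of `ker (Ψ x₀)` the map `Ψ x₀` is bounded below, and this survives small
perturbations. It yields lower semicontinuity of the rank and, for constant rank, the splitting of
`F` into `ker (Ψ x)` and one fixed `Q`. -/
theorem exists_submodule_antilipschitz {Ψ : X → F →L[ℝ] G} {x₀ : X} (h : ContinuousAt Ψ x₀) :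
    ∃ Q : Submodule ℝ F,
      Module.finrank ℝ Q = Module.finrank ℝ (LinearMap.range (Ψ x₀).toLinearMap) ∧
      ∃ c : ℝ, 0 < c ∧ ∀ᶠ x in 𝓝 x₀, ∀ q ∈ Q, ‖q‖ ≤ c * ‖Ψ x q‖ := by
  obtain ⟨Q, hQ⟩ := Submodule.exists_isCompl (LinearMap.ker (Ψ x₀).toLinearMap)
  refine ⟨Q, ?_, ?_⟩
  · have h1 := Submodule.finrank_add_eq_of_isCompl hQ
    have h2 := LinearMap.finrank_range_add_finrank_ker (Ψ x₀).toLinearMap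
    omega
  · have hker : LinearMap.ker ((Ψ x₀).toLinearMap.comp Q.subtype) = ⊥ := by
      rw [LinearMap.ker_eq_bot']
      intro q hq
      have : (q : F) ∈ LinearMap.ker (Ψ x₀).toLinearMap ⊓ Q := ⟨hq, q.2⟩
      rw [hQ.inf_eq_bot] at this
      exact Subtype.ext this
    obtain ⟨K, hK, hA⟩ := LinearMap.exists_antilipschitzWith _ hker
    -- A perturbation of norm below `1 / (2 * K)` costs at most half of `‖q‖`; hence the factor 2.
    refine ⟨2 * K, by positivity, ?_⟩
    have hK' : (0 : ℝ) < K := hK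
    have hev : ∀ᶠ x in 𝓝 x₀, ‖Ψ x - Ψ x₀‖ < 1 / (2 * K) := by
      have := (tendsto_iff_norm_sub_tendsto_zero.1 h).eventually (gt_mem_nhds (show
        (0 : ℝ) < 1 / (2 * K) by positivity))
      exact this
    filter_upwards [hev] with x hx q hq
    have h1 : ‖q‖ ≤ K * ‖Ψ x₀ q‖ := by
      have := ZeroHomClass.bound_of_antilipschitz _ hA ⟨q, hq⟩
      simpa using this
    have h2 : ‖Ψ x₀ q‖ ≤ ‖Ψ x q‖ + 1 / (2 * K) * ‖q‖ := by
      have h3 : Ψ x₀ q = Ψ x q - (Ψ x - Ψ x₀) q := by simp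
      rw [h3]
      refine (norm_sub_le _ _).trans (add_le_add le_rfl ?_)
      exact (ContinuousLinearMap.le_opNorm _ _).trans
        (mul_le_mul_of_nonneg_right hx.le (norm_nonneg _))
    have h4 : K * ‖Ψ x₀ q‖ ≤ K * ‖Ψ x q‖ + ‖q‖ / 2 := by
      calc K * ‖Ψ x₀ q‖ ≤ K * (‖Ψ x q‖ + 1 / (2 * K) * ‖q‖) :=
            mul_le_mul_of_nonneg_left h2 hK'.le
        _ = _ := by field_simp
    linarith

theorem eventually_finrank_range_le {Ψ : X → F →L[ℝ] G} {x₀ : X} (h : ContinuousAt Ψ x₀) :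
    ∀ᶠ x in 𝓝 x₀, Module.finrank ℝ (LinearMap.range (Ψ x₀).toLinearMap) ≤
      Module.finrank ℝ (LinearMap.range (Ψ x).toLinearMap) := by
  obtain ⟨Q, hQ, c, hc, hev⟩ := exists_submodule_antilipschitz h
  filter_upwards [hev] with x hx
  rw [← hQ]
  have hinj : Function.Injective ((Ψ x).toLinearMap.rangeRestrict.comp Q.subtype) := by
    rw [← LinearMap.ker_eq_bot, LinearMap.ker_eq_bot']
    intro q hq
    have h0 : Ψ x q = 0 := congrArg Subtype.val hq
    have := hx q q.2
    rw [h0, norm_zero, mul_zero] at this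
    exact Subtype.ext (norm_le_zero_iff.1 this)
  exact LinearMap.finrank_le_finrank_of_injective hinj

/-- For a family of constant rank, a family with larger kernels is locally uniformly dominated. -/
theorem eventually_norm_le_of_ker_le {Ψ : X → F →L[ℝ] G} {Ψ' : X → F →L[ℝ] G'} {x₀ : X}
    (h : ContinuousAt Ψ x₀) (h' : ContinuousAt Ψ' x₀)
    (hrank : ∀ᶠ x in 𝓝 x₀, Module.finrank ℝ (LinearMap.range (Ψ x).toLinearMap) =
      Module.finrank ℝ (LinearMap.range (Ψ x₀).toLinearMap))
    (hker : ∀ᶠ x in 𝓝 x₀, ∀ M, Ψ x M = 0 → Ψ' x M = 0) :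
    ∃ K : ℝ, 0 ≤ K ∧ ∀ᶠ x in 𝓝 x₀, ∀ M, ‖Ψ' x M‖ ≤ K * ‖Ψ x M‖ := by
  obtain ⟨Q, hQ, c, hc, hev⟩ := exists_submodule_antilipschitz h
  refine ⟨(‖Ψ' x₀‖ + 1) * c, by positivity, ?_⟩
  have hb : ∀ᶠ x in 𝓝 x₀, ‖Ψ' x‖ < ‖Ψ' x₀‖ + 1 :=
    h'.norm.eventually (gt_mem_nhds (lt_add_one _))
  filter_upwards [hev, hrank, hker, hb] with x hx hr hk hbx M
  have hdisj : Disjoint (LinearMap.ker (Ψ x).toLinearMap) Q := by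
    rw [Submodule.disjoint_def]
    intro q hq hqQ
    have h0 : Ψ x q = 0 := hq
    have := hx q hqQ
    rw [h0, norm_zero, mul_zero] at this
    exact norm_le_zero_iff.1 this
  -- A dimension count, and the only use of the constancy of the rank. Both maps vanish on the
  -- kernel summand, so the estimate is needed on `Q` alone.
  have hsup : LinearMap.ker (Ψ x).toLinearMap ⊔ Q = ⊤ := by
    apply Submodule.eq_top_of_finrank_eq
    have h1 := Submodule.finrank_sup_add_finrank_inf_eq (LinearMap.ker (Ψ x).toLinearMap) Q
    rw [hdisj.eq_bot, finrank_bot] at h1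
    have h2 := LinearMap.finrank_range_add_finrank_ker (Ψ x).toLinearMap
    omega
  have hM : M ∈ LinearMap.ker (Ψ x).toLinearMap ⊔ Q := hsup ▸ Submodule.mem_top
  obtain ⟨n, hn, q, hq, rfl⟩ := Submodule.mem_sup.1 hM
  have hn0 : Ψ x n = 0 := hn
  rw [map_add, map_add, hn0, hk n hn0, zero_add, zero_add]
  calc ‖Ψ' x q‖ ≤ ‖Ψ' x‖ * ‖q‖ := ContinuousLinearMap.le_opNorm _ _
    _ ≤ (‖Ψ' x₀‖ + 1) * (c * ‖Ψ x q‖) := by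
      gcongr
      exact hx q hq
    _ = _ := by ring

end ConstantRank

/-! ### Covariant derivatives of linear equations -/

section Prolongation

variable {E F G G' : Type*} [NormedAddCommGroup E] [NormedSpace ℝ E]
  [NormedAddCommGroup F] [NormedSpace ℝ F]
  [NormedAddCommGroup G] [NormedSpace ℝ G] [NormedAddCommGroup G'] [NormedSpace ℝ G']

/-- The covariant derivative of the family of equations `Ψ z M = 0` in the direction `v`, with
respect to the connection `dM = A M`. -/
def covDeriv (A : E → E →L[ℝ] F →L[ℝ] F) (Ψ : E → F →L[ℝ] G) (z v : E) (M : F) : G :=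
  fderiv ℝ Ψ z v M + Ψ z (A z v M)

/-- The curve in the total space is horizontal to first order, so covariant derivatives become
ordinary derivatives in `t`, to which norm estimates apply. -/
theorem hasDerivAt_covDeriv (A : E → E →L[ℝ] F →L[ℝ] F) {Ψ : E → F →L[ℝ] G} {z : E}
    (h : DifferentiableAt ℝ Ψ z) (v : E) (M : F) :
    HasDerivAt (fun t : ℝ => Ψ (z + t • v) (M + t • A z v M)) (covDeriv A Ψ z v M) 0 := by
  have hl : HasDerivAt (fun t : ℝ => z + t • v) v 0 := by
    simpa using ((hasDerivAt_id (0 : ℝ)).smul_const v).const_add z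
  have hm : HasDerivAt (fun t : ℝ => M + t • A z v M) (A z v M) 0 := by
    simpa using ((hasDerivAt_id (0 : ℝ)).smul_const (A z v M)).const_add M
  have hc : HasDerivAt (fun t : ℝ => Ψ (z + t • v)) (fderiv ℝ Ψ z v) 0 :=
    h.hasFDerivAt.comp_hasDerivAt_of_eq (0 : ℝ) hl (by simp)
  have := hc.clm_apply hm
  simpa [covDeriv] using this

/-- Along the horizontal curve `Ψ` applied to the fibre component is `o(t)`; by the bound so is
`Ψ'`, and its derivative at `0` vanishes. This avoids writing the rows of `Ψ'` as differentiable
combinations of those of `Ψ`. -/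
theorem covDeriv_eq_zero_of_norm_le {A : E → E →L[ℝ] F →L[ℝ] F} {Ψ : E → F →L[ℝ] G}
    {Ψ' : E → F →L[ℝ] G'} {z v : E} {M : F} {K : ℝ}
    (h : DifferentiableAt ℝ Ψ z) (h' : DifferentiableAt ℝ Ψ' z)
    (hK : ∀ᶠ x in 𝓝 z, ∀ M, ‖Ψ' x M‖ ≤ K * ‖Ψ x M‖)
    (h0 : Ψ z M = 0) (h1 : covDeriv A Ψ z v M = 0) : covDeriv A Ψ' z v M = 0 := by
  have hd := hasDerivAt_covDeriv A h v M
  have hd' := hasDerivAt_covDeriv A h' v M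
  have e0 : Ψ z M = 0 := h0
  have e0' : Ψ' z M = 0 := by
    have := hK.self_of_nhds M
    rw [e0, norm_zero, mul_zero] at this
    exact norm_le_zero_iff.1 this
  rw [h1] at hd
  have ho := hd.isLittleO
  have hlim : Tendsto (fun t : ℝ => z + t • v) (𝓝 0) (𝓝 z) := by
    have : Continuous fun t : ℝ => z + t • v := by fun_prop
    simpa using this.tendsto 0
  have hO : (fun t : ℝ => Ψ' (z + t • v) (M + t • A z v M)) =O[𝓝 0]
      fun t : ℝ => Ψ (z + t • v) (M + t • A z v M) := by
    refine Asymptotics.IsBigO.of_bound K ?_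
    filter_upwards [hlim.eventually hK] with t ht
    exact ht _
  have hd0 : HasDerivAt (fun t : ℝ => Ψ' (z + t • v) (M + t • A z v M)) 0 0 := by
    rw [hasDerivAt_iff_isLittleO]
    simpa [e0, e0'] using hO.trans_isLittleO (by simpa [e0] using ho)
  exact hd'.unique hd0

end Prolongation

/-! ### Linear ODEs on the unit interval -/

section LinearODE

variable {F : Type*} [NormedAddCommGroup F] [NormedSpace ℝ F]

/-- In the ball of radius `‖x₀‖` about `x₀` the speed is at most `1 / 2 * (2 * ‖x₀‖) = ‖x₀‖`, so a
single Picard–Lindelöf step covers all of `[0, 1]`. -/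
theorem exists_linearODE_solution [CompleteSpace F] {B : ℝ → F →L[ℝ] F}
    (hB : ContinuousOn B (Set.Icc 0 1))
    (hbound : ∀ t ∈ Set.Icc (0 : ℝ) 1, ‖B t‖ ≤ 1 / 2) (x₀ : F) :
    ∃ g : ℝ → F, g 0 = x₀ ∧
      ∀ t ∈ Set.Icc (0 : ℝ) 1, HasDerivWithinAt g (B t (g t)) (Set.Icc 0 1) t := by
  have hp : IsPicardLindelof (fun t x => B t x) (tmin := 0) (tmax := 1)
      ⟨0, by simp⟩ x₀ ‖x₀‖₊ 0 ‖x₀‖₊ (1 / 2) := by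
    refine ⟨?_, ?_, ?_, ?_⟩
    · intro t ht
      refine ((B t).lipschitz.weaken ?_).lipschitzOnWith
      exact_mod_cast hbound t ht
    · intro x _
      exact hB.clm_apply continuousOn_const
    · intro t ht x hx
      have h1 : ‖x‖ ≤ 2 * ‖x₀‖ := by
        have := norm_le_of_mem_closedBall hx
        simp only [coe_nnnorm] at this
        linarith
      calc ‖B t x‖ ≤ ‖B t‖ * ‖x‖ := ContinuousLinearMap.le_opNorm _ _
        _ ≤ 1 / 2 * (2 * ‖x₀‖) := by
          gcongr
          exact hbound t ht
        _ = _ := by simp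
    · simp
  obtain ⟨g, hg, hg'⟩ := hp.exists_eq_forall_mem_Icc_hasDerivWithinAt₀
  exact ⟨g, hg, hg'⟩

theorem norm_le_of_hasDerivWithinAt_Icc {y y' : ℝ → F} {K ε : ℝ}
    (hy : ∀ t ∈ Set.Icc (0 : ℝ) 1, HasDerivWithinAt y (y' t) (Set.Icc 0 1) t) (h0 : y 0 = 0)
    (hb : ∀ t ∈ Set.Icc (0 : ℝ) 1, ‖y' t‖ ≤ K * ‖y t‖ + ε) :
    ∀ t ∈ Set.Icc (0 : ℝ) 1, ‖y t‖ ≤ gronwallBound 0 K ε t := by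
  intro t ht
  have := norm_le_gronwallBound_of_norm_deriv_right_le (f := y) (f' := y') (δ := 0) (K := K)
    (ε := ε) (a := 0) (b := 1) (fun t ht => (hy t ht).continuousWithinAt)
    (fun t ht => (hy t ⟨ht.1, ht.2.le⟩).mono_of_mem_nhdsWithin (Icc_mem_nhdsGE_of_mem ht))
    (by simp [h0]) (fun t ht => hb t ⟨ht.1, ht.2.le⟩) t ht
  simpa using this

theorem eq_zero_of_hasDerivWithinAt_Icc {y y' : ℝ → F} {K : ℝ}
    (hy : ∀ t ∈ Set.Icc (0 : ℝ) 1, HasDerivWithinAt y (y' t) (Set.Icc 0 1) t) (h0 : y 0 = 0)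
    (hb : ∀ t ∈ Set.Icc (0 : ℝ) 1, ‖y' t‖ ≤ K * ‖y t‖) :
    ∀ t ∈ Set.Icc (0 : ℝ) 1, y t = 0 := by
  intro t ht
  have := norm_le_of_hasDerivWithinAt_Icc (ε := 0) hy h0 (by simpa using hb) t ht
  rw [gronwallBound_ε0_δ0] at this
  exact norm_le_zero_iff.1 this

end LinearODE

/-! ### Parallel sections of a connection that is flat on a subbundle -/

section FlatSections

variable {E F G : Type*} [NormedAddCommGroup E] [NormedSpace ℝ E]
  [NormedAddCommGroup F] [NormedSpace ℝ F] [NormedAddCommGroup G] [NormedSpace ℝ G]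

/-- The curvature of the connection `dM = A M`. -/
def curvature (A : E → E →L[ℝ] F →L[ℝ] F) (z v w : E) (M : F) : F :=
  fderiv ℝ A z w v M - fderiv ℝ A z v w M + (A z v (A z w M) - A z w (A z v M))

/-- The derivative of a `C²` map is locally Lipschitz, and the mean value inequality turns this into
a quadratic Taylor remainder. The bounds hold for all small `ρ` with the same constants, which
leaves room to shrink the ball afterwards. -/
theorem exists_quadratic_remainder {H : Type*} [NormedAddCommGroup H] [NormedSpace ℝ H]
    {A : E → H} {z₀ : E} (hA : ContDiffAt ℝ 2 A z₀) :
    ∃ L C C' : ℝ, 0 ≤ L ∧ 0 < C ∧ 0 < C' ∧ ∀ᶠ ρ in 𝓝[>] (0 : ℝ),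
      ∀ z ∈ Metric.ball z₀ ρ, DifferentiableAt ℝ A z ∧ ‖A z‖ ≤ C ∧
        (∀ v, ‖fderiv ℝ A z v‖ ≤ C' * ‖v‖) ∧
        ∀ v, z + v ∈ Metric.ball z₀ ρ → ‖A (z + v) - A z - fderiv ℝ A z v‖ ≤ L * ‖v‖ ^ 2 := by
  have h1 : ContDiffAt ℝ 1 (fderiv ℝ A) z₀ := hA.fderiv_right (by norm_num)
  obtain ⟨K, t, ht, hK⟩ := h1.exists_lipschitzOnWith
  have hd : ∀ᶠ z in 𝓝 z₀, DifferentiableAt ℝ A z := by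
    filter_upwards [hA.eventually (by simp)] with z hz
    exact hz.differentiableAt (by simp)
  have hC : ∀ᶠ z in 𝓝 z₀, ‖A z‖ < ‖A z₀‖ + 1 :=
    hA.continuousAt.norm.eventually (gt_mem_nhds (lt_add_one _))
  have hC' : ∀ᶠ z in 𝓝 z₀, ‖fderiv ℝ A z‖ < ‖fderiv ℝ A z₀‖ + 1 :=
    h1.continuousAt.norm.eventually
      (gt_mem_nhds (lt_add_one _))
  obtain ⟨ρ₀, hρ₀, hsub₀⟩ := Metric.eventually_nhds_iff_ball.1
    (hd.and ((show ∀ᶠ z in 𝓝 z₀, z ∈ t from ht).and (hC.and hC')))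
  refine ⟨K, ‖A z₀‖ + 1, ‖fderiv ℝ A z₀‖ + 1, K.2, by positivity, by positivity, ?_⟩
  filter_upwards [Ioo_mem_nhdsGT hρ₀] with ρ hρ z hz
  have hsub := fun y (hy : y ∈ Metric.ball z₀ ρ) =>
    hsub₀ y (Metric.ball_subset_ball hρ.2.le hy)
  refine ⟨(hsub z hz).1, (hsub z hz).2.2.1.le, fun v => ?_, fun v hv => ?_⟩
  · exact (ContinuousLinearMap.le_opNorm _ _).trans (by gcongr; exact (hsub z hz).2.2.2.le)
  have := Convex.norm_image_sub_le_of_norm_hasFDerivWithin_le' (f := A)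
    (f' := fderiv ℝ A) (φ := fderiv ℝ A z) (C := K * ‖v‖) (s := segment ℝ z (z + v))
    (x := z) (y := z + v) (fun x hx => ?_) (fun x hx => ?_) (convex_segment _ _)
    (left_mem_segment _ _ _) (right_mem_segment _ _ _)
  · simpa [sq, mul_assoc] using this
  · exact (hsub x ((convex_ball z₀ ρ).segment_subset hz hv hx)).1.hasFDerivAt.hasFDerivWithinAt
  · have hx' := (convex_ball z₀ ρ).segment_subset hz hv hx
    refine (hK.norm_sub_le (hsub x hx').2.1 (hsub z hz).2.1).trans ?_
    gcongr
    have := norm_sub_le_of_mem_segment hx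
    simpa using this

/-- The section is parallel transport of `M₀` along rays from `z₀`. Its derivative is found by
comparing neighbouring rays: the first-order discrepancy is a curvature term, which vanishes because
the transported vector stays in the kernel. No smooth dependence of ODE solutions on parameters is
used. -/
theorem exists_flat_section [CompleteSpace F] {A : E → E →L[ℝ] F →L[ℝ] F} {Ψ : E → F →L[ℝ] G}
    {z₀ : E} (hA : ContDiffAt ℝ 2 A z₀) (hΨ : ∀ᶠ z in 𝓝 z₀, DifferentiableAt ℝ Ψ z) {K : ℝ}
    (hK : ∀ᶠ z in 𝓝 z₀, ∀ v M, ‖covDeriv A Ψ z v M‖ ≤ K * ‖v‖ * ‖Ψ z M‖)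
    (hcurv : ∀ᶠ z in 𝓝 z₀, ∀ M, Ψ z M = 0 → ∀ v w, curvature A z v w M = 0) :
    ∃ ρ > 0, ∀ M₀, Ψ z₀ M₀ = 0 → ∃ M : E → F, M z₀ = M₀ ∧ ∀ z ∈ Metric.ball z₀ ρ,
      HasFDerivAt M ((A z).flip (M z)) z ∧ Ψ z (M z) = 0  := by
  obtain ⟨L, C, C', hL, hC0, hC'0, hAev⟩ := exists_quadratic_remainder hA
  obtain ⟨ρ₂, hρ₂, hsub₂⟩ := Metric.eventually_nhds_iff_ball.1 (hΨ.and (hK.and hcurv))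
  obtain ⟨ρ, hAρ, hρ, hρlt⟩ := (hAev.and (Ioo_mem_nhdsGT
    (show (0 : ℝ) < min ρ₂ (1 / (2 * C)) by positivity))).exists
  -- Ensures norm at most `1 / 2` for the ODE coefficient along every ray, as
  -- `exists_linearODE_solution` requires.
  have hρC : C * ρ ≤ 1 / 2 := by
    calc C * ρ ≤ C * (1 / (2 * C)) := by
          gcongr
          exact hρlt.le.trans (min_le_right _ _)
      _ = 1 / 2 := by field_simp
  have hsub := fun y (hy : y ∈ Metric.ball z₀ ρ) =>
    hsub₂ y (Metric.ball_subset_ball (hρlt.le.trans (min_le_left _ _)) hy)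
  refine ⟨ρ, hρ, fun M₀ hM₀ => ?_⟩
  have hray : ∀ z ∈ Metric.ball z₀ ρ, ∀ t ∈ Set.Icc (0 : ℝ) 1,
      z₀ + t • (z - z₀) ∈ Metric.ball z₀ ρ := by
    intro z hz t ht
    rw [mem_ball_iff_norm] at hz ⊢
    rw [add_sub_cancel_left, norm_smul, Real.norm_of_nonneg ht.1]
    exact (mul_le_of_le_one_left (norm_nonneg _) ht.2).trans_lt hz
  have hAcont : ∀ z ∈ Metric.ball z₀ ρ,
      ContinuousOn (fun t : ℝ => A (z₀ + t • (z - z₀)) (z - z₀)) (Set.Icc 0 1) := by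
    intro z hz t ht
    have h1 := (hAρ _ (hray z hz t ht)).1.continuousAt
    have h2 : ContinuousAt (fun t : ℝ => z₀ + t • (z - z₀)) t := by fun_prop
    have h3 : ContinuousAt (fun t : ℝ => A (z₀ + t • (z - z₀))) t :=
      ContinuousAt.comp (f := fun t : ℝ => z₀ + t • (z - z₀)) h1 h2
    exact (h3.clm_apply continuousAt_const).continuousWithinAt
  have hAbound : ∀ z ∈ Metric.ball z₀ ρ, ∀ t ∈ Set.Icc (0 : ℝ) 1,
      ‖A (z₀ + t • (z - z₀)) (z - z₀)‖ ≤ 1 / 2 := by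
    intro z hz t ht
    have h1 := (hAρ _ (hray z hz t ht)).2.1
    rw [mem_ball_iff_norm] at hz
    refine (ContinuousLinearMap.le_opNorm _ _).trans ((mul_le_mul h1 hz.le
      (norm_nonneg _) hC0.le).trans hρC)
  have hode : ∀ z : E, ∃ g : ℝ → F, z ∈ Metric.ball z₀ ρ → (g 0 = M₀ ∧
      ∀ t ∈ Set.Icc (0 : ℝ) 1, HasDerivWithinAt g (A (z₀ + t • (z - z₀)) (z - z₀) (g t))
        (Set.Icc 0 1) t) := by
    intro z
    by_cases hz : z ∈ Metric.ball z₀ ρ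
    · obtain ⟨g, hg⟩ := exists_linearODE_solution (hAcont z hz) (hAbound z hz) M₀
      exact ⟨g, fun _ => hg⟩
    · exact ⟨0, fun h => absurd h hz⟩
  choose g hg using hode
  -- the solutions along rays stay in the kernel
  have hker : ∀ z ∈ Metric.ball z₀ ρ, ∀ t ∈ Set.Icc (0 : ℝ) 1,
      Ψ (z₀ + t • (z - z₀)) (g z t) = 0 := by
    intro z hz
    obtain ⟨hg0, hg1⟩ := hg z hz
    -- The derivative of `Ψ` applied to the transported vector is `covDeriv`, which `hK` bounds by
    -- the function itself.
    refine eq_zero_of_hasDerivWithinAt_Icc (K := K * ‖z - z₀‖)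
      (y' := fun t => covDeriv A Ψ (z₀ + t • (z - z₀)) (z - z₀) (g z t)) ?_ (by simp [hg0, hM₀]) ?_
    · intro t ht
      have hl : HasDerivWithinAt (fun t : ℝ => z₀ + t • (z - z₀)) (z - z₀) (Set.Icc 0 1) t := by
        simpa using (((hasDerivAt_id t).smul_const (z - z₀)).const_add z₀).hasDerivWithinAt
      have hc : HasDerivWithinAt (fun t : ℝ => Ψ (z₀ + t • (z - z₀)))
          (fderiv ℝ Ψ (z₀ + t • (z - z₀)) (z - z₀)) (Set.Icc 0 1) t :=
        (hsub _ (hray z hz t ht)).1.hasFDerivAt.comp_hasDerivWithinAt t hl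
      exact hc.clm_apply (hg1 t ht)
    · intro t ht
      exact (hsub _ (hray z hz t ht)).2.1 _ _
  refine ⟨fun z => g z 1, ?_, fun z hz => ⟨?_, by simpa using hker z hz 1 (by simp)⟩⟩
  · have hz : z₀ ∈ Metric.ball z₀ ρ := Metric.mem_ball_self hρ
    obtain ⟨hg0, hg1⟩ := hg z₀ hz
    have : ∀ t ∈ Set.Icc (0 : ℝ) 1, g z₀ t - M₀ = 0 := by
      refine eq_zero_of_hasDerivWithinAt_Icc (K := 0) (y' := fun _ => 0) ?_ (by simp [hg0]) ?_
      · intro t ht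
        simpa using (hg1 t ht).sub_const M₀
      · simp
    simpa [sub_eq_zero] using this 1 (by simp)
  · obtain ⟨hg0, hg1⟩ := hg z hz
    set w := z - z₀ with hw
    have hwρ : ‖w‖ ≤ ρ := (mem_ball_iff_norm.1 hz).le
    obtain ⟨Γ, hΓ⟩ := isCompact_Icc.exists_bound_of_continuousOn
      (f := g z) (s := Set.Icc (0 : ℝ) 1) fun t ht => (hg1 t ht).continuousWithinAt
    have hΓ0 : 0 ≤ Γ := (norm_nonneg _).trans (hΓ 0 (by simp))
    -- The four summands bound the error terms `b1` to `b4` below. The constant in `hest` is the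
    -- Gronwall bound at time 1 with rate `1 / 2` and forcing `D * ‖v‖ ^ 2`.
    set D := C * C * Γ + C' * Γ + C' * ρ * (C * Γ) + L * ρ * ((1 + C) * Γ) with hD
    have hest : ∀ v, ‖v‖ ≤ 1 → z + v ∈ Metric.ball z₀ ρ →
        ‖g (z + v) 1 - g z 1 - A z v (g z 1)‖ ≤
          (D / (1 / 2) * (Real.exp (1 / 2) - 1)) * ‖v‖ ^ 2 := by
      intro v hv1 hv
      obtain ⟨hG0, hG1⟩ := hg (z + v) hv
      have hwv : z + v - z₀ = w + v := by rw [hw]; abel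
      rw [hwv] at hG1
      have hwvρ : ‖w + v‖ ≤ ρ := by rw [← hwv]; exact (mem_ball_iff_norm.1 hv).le
      set a : ℝ → E := fun t => z₀ + t • w with ha
      have hat : ∀ t ∈ Set.Icc (0 : ℝ) 1, a t ∈ Metric.ball z₀ ρ := hray z hz
      have hatv : ∀ t ∈ Set.Icc (0 : ℝ) 1, a t + t • v ∈ Metric.ball z₀ ρ := by
        intro t ht
        have := hray _ hv t ht
        rwa [hwv, smul_add, ← add_assoc] at this
      -- A first-order guess for the solution on the ray to `z + v`: the point `a t` moves by `t •
      -- v`, so the solution on the old ray is corrected by the connection in that direction. At `t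
      -- = 1` it gives the claimed derivative.
      set N : ℝ → F := fun t => g z t + t • A (a t) v (g z t) with hN
      set N' : ℝ → F := fun t => A (a t) w (g z t) + (A (a t) v (g z t) +
        t • (fderiv ℝ A (a t) w v (g z t) + A (a t) v (A (a t) w (g z t)))) with hN'
      have hNd : ∀ t ∈ Set.Icc (0 : ℝ) 1, HasDerivWithinAt N (N' t) (Set.Icc 0 1) t := by
        intro t ht
        have hl : HasDerivWithinAt a w (Set.Icc 0 1) t := by
          exact ((((hasDerivAt_id t).smul_const w).const_add z₀).congr_deriv
            (one_smul ℝ w)).hasDerivWithinAt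
        have hc : HasDerivWithinAt (fun t : ℝ => A (a t)) (fderiv ℝ A (a t) w) (Set.Icc 0 1) t :=
          (hAρ _ (hat t ht)).1.hasFDerivAt.comp_hasDerivWithinAt t hl
        have h2 := (hc.clm_apply (hasDerivWithinAt_const t _ v)).clm_apply (hg1 t ht)
        have h3 := (hg1 t ht).add ((hasDerivWithinAt_id t (Set.Icc 0 1)).smul h2)
        refine h3.congr_deriv ?_
        simp only [hN', ha, map_zero, add_zero, id]
        rw [one_smul]
        abel
      have hyd : ∀ t ∈ Set.Icc (0 : ℝ) 1, HasDerivWithinAt (fun t => g (z + v) t - N t)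
          (A (z₀ + t • (w + v)) (w + v) (g (z + v) t) - N' t) (Set.Icc 0 1) t :=
        fun t ht => (hG1 t ht).sub (hNd t ht)
      have hbd : ∀ t ∈ Set.Icc (0 : ℝ) 1,
          ‖A (z₀ + t • (w + v)) (w + v) (g (z + v) t) - N' t‖ ≤
            1 / 2 * ‖g (z + v) t - N t‖ + D * ‖v‖ ^ 2 := by
        intro t ht
        have e1 : z₀ + t • (w + v) = a t + t • v := by rw [ha, smul_add, ← add_assoc]
        rw [e1]
        set R := A (a t + t • v) - A (a t) - fderiv ℝ A (a t) (t • v) with hR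
        have hRn : ‖R‖ ≤ L * ‖v‖ ^ 2 := by
          refine ((hAρ _ (hat t ht)).2.2.2 _ (hatv t ht)).trans ?_
          gcongr
          rw [norm_smul, Real.norm_of_nonneg ht.1]
          exact mul_le_of_le_one_left (norm_nonneg _) ht.2
        have hAR : A (a t + t • v) = A (a t) + t • fderiv ℝ A (a t) v + R := by
          rw [hR, map_smul]; abel
        have hcu := (hsub _ (hat t ht)).2.2 _ (hker z hz t ht) w v
        -- After Taylor expansion of `A`, the terms of first order in `v` that `N'` does not cancel
        -- add up to `t` times the curvature on `(w, v)`, which is zero here. The rest is quadratic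
        -- in `v`.
        have hsplit : A (a t + t • v) (w + v) (g (z + v) t) - N' t =
            A (a t + t • v) (w + v) (g (z + v) t - N t) +
            (t • A (a t) v (A (a t) v (g z t)) + t • fderiv ℝ A (a t) v v (g z t)
              + (t * t) • fderiv ℝ A (a t) v (w + v) (A (a t) v (g z t))
              + R (w + v) (N t)) := by
          have h0 : t • curvature A (a t) w v (g z t) = 0 := by rw [hcu, smul_zero]
          rw [← sub_eq_zero, ← h0, map_sub]
          nth_rewrite 3 [hAR]
          simp only [hN, hN', curvature, map_add, map_smul, _root_.add_apply, _root_.smul_apply]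
          module
        rw [hsplit]
        have hgt := hΓ t ht
        have hAn := (hAρ _ (hat t ht)).2.1
        have hA'n := (hAρ _ (hat t ht)).2.2.1
        have ht0 := ht.1
        have ht1 := ht.2
        have hAv : ∀ x, ‖A (a t) v x‖ ≤ C * ‖v‖ * ‖x‖ := fun x =>
          (ContinuousLinearMap.le_opNorm₂ _ _ _).trans (by gcongr)
        have hA'v : ∀ u x, ‖fderiv ℝ A (a t) v u x‖ ≤ C' * ‖v‖ * ‖u‖ * ‖x‖ := fun u x =>
          (ContinuousLinearMap.le_opNorm₂ _ _ _).trans (by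
            gcongr
            exact hA'n v)
        have hvg : ‖A (a t) v (g z t)‖ ≤ C * ‖v‖ * Γ := (hAv _).trans (by gcongr)
        have b1 : ‖t • A (a t) v (A (a t) v (g z t))‖ ≤ 1 * (C * ‖v‖ * (C * ‖v‖ * Γ)) := by
          rw [norm_smul, Real.norm_of_nonneg ht0]
          gcongr
          exact (hAv _).trans (by gcongr)
        have b2 : ‖t • fderiv ℝ A (a t) v v (g z t)‖ ≤ 1 * (C' * ‖v‖ * ‖v‖ * Γ) := by
          rw [norm_smul, Real.norm_of_nonneg ht0]
          gcongr
          exact (hA'v _ _).trans (by gcongr)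
        have b3 : ‖(t * t) • fderiv ℝ A (a t) v (w + v) (A (a t) v (g z t))‖ ≤
            1 * (C' * ‖v‖ * ρ * (C * ‖v‖ * Γ)) := by
          rw [norm_smul, Real.norm_of_nonneg (mul_nonneg ht0 ht0)]
          gcongr
          · exact mul_le_one₀ ht1 ht0 ht1
          · exact (hA'v _ _).trans (by gcongr)
        have hNt : ‖N t‖ ≤ (1 + C) * Γ := by
          have : ‖t • A (a t) v (g z t)‖ ≤ 1 * (C * 1 * Γ) := by
            rw [norm_smul, Real.norm_of_nonneg ht0]
            gcongr
            exact hvg.trans (by gcongr)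
          calc ‖N t‖ ≤ ‖g z t‖ + ‖t • A (a t) v (g z t)‖ := norm_add_le _ _
            _ ≤ Γ + 1 * (C * 1 * Γ) := add_le_add hgt this
            _ = _ := by ring
        have b4 : ‖R (w + v) (N t)‖ ≤ L * ‖v‖ ^ 2 * ρ * ((1 + C) * Γ) :=
          (ContinuousLinearMap.le_opNorm₂ _ _ _).trans (by gcongr)
        have b0 : ‖A (a t + t • v) (w + v) (g (z + v) t - N t)‖ ≤
            1 / 2 * ‖g (z + v) t - N t‖ := by
          have h5 := hAbound _ hv t ht
          rw [hwv, e1] at h5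
          exact (ContinuousLinearMap.le_opNorm _ _).trans (by gcongr)
        refine (norm_add_le _ _).trans (add_le_add b0 ?_)
        refine (norm_add_le _ _).trans ?_
        refine (add_le_add ((norm_add_le _ _).trans (add_le_add ((norm_add_le _ _).trans
          (add_le_add b1 b2)) b3)) b4).trans (le_of_eq ?_)
        rw [hD]
        ring
      have := norm_le_of_hasDerivWithinAt_Icc hyd (by simp [hN, hG0, hg0]) hbd 1 (by simp)
      rw [gronwallBound_of_K_ne_0 (by norm_num)] at this
      have ha1 : a 1 = z := by simp [ha, hw]
      simp only [hN, ha1, one_smul, zero_mul, zero_add, mul_one] at this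
      rw [sub_sub]
      refine this.trans (le_of_eq ?_)
      ring
    rw [hasFDerivAt_iff_isLittleO_nhds_zero]
    have hev : ∀ᶠ v in 𝓝 (0 : E), ‖v‖ ≤ 1 ∧ z + v ∈ Metric.ball z₀ ρ := by
      refine Filter.Eventually.and ?_ ?_
      · filter_upwards [Metric.ball_mem_nhds (0 : E) one_pos] with v hv
        exact (mem_ball_zero_iff.1 hv).le
      · have hlim : Tendsto (fun v : E => z + v) (𝓝 0) (𝓝 z) := by
          have : Continuous fun v : E => z + v := by fun_prop
          simpa using this.tendsto 0
        exact hlim.eventually (Metric.isOpen_ball.mem_nhds hz)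
    have hO : (fun v => g (z + v) 1 - g z 1 - ((A z).flip (g z 1)) v) =O[𝓝 0]
        fun v : E => ‖v‖ ^ 2 := by
      refine Asymptotics.IsBigO.of_bound (D / (1 / 2) * (Real.exp (1 / 2) - 1)) ?_
      filter_upwards [hev] with v hv
      simpa using hest v hv.1 hv.2
    refine hO.trans_isLittleO ?_
    have := Asymptotics.isLittleO_norm_pow_id (E' := E) one_lt_two
    exact this

/-- Bootstrapping: the derivative is bilinear in `A` and `M`, so it is as regular as `M` already is.
-/
theorem contDiffOn_of_hasFDerivAt_flat [FiniteDimensional ℝ E]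
    {A : E → E →L[ℝ] F →L[ℝ] F} {M : E → F} {O : Set E} (hO : IsOpen O) (hA : ContDiffOn ℝ ∞ A O)
    (hM : ∀ z ∈ O, HasFDerivAt M ((A z).flip (M z)) z) : ContDiffOn ℝ ∞ M O := by
  rw [contDiffOn_infty]
  intro n
  induction n with
  | zero =>
    exact contDiffOn_zero.2 fun z hz => (hM z hz).continuousAt.continuousWithinAt
  | succ n ih =>
    have : ((n + 1 : ℕ) : ℕ∞ω) = (n : ℕ∞ω) + 1 := by push_cast; rfl
    rw [this, contDiffOn_succ_iff_fderiv_of_isOpen hO]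
    refine ⟨fun z hz => (hM z hz).differentiableAt.differentiableWithinAt, by simp, ?_⟩
    refine contDiffOn_clm_apply.2 fun v => ?_
    exact (((contDiffOn_infty.1 hA n).clm_apply contDiffOn_const).clm_apply ih).congr
      fun z hz => by rw [(hM z hz).fderiv]; rfl

/-- Restricted to a ray, a parallel section solves a linear ODE with initial value zero. This is the
injectivity of evaluation at `z₀`. -/
theorem flat_section_eq_zero {A : E → E →L[ℝ] F →L[ℝ] F} {M : E → F} {z₀ : E} {ρ C : ℝ}
    (hC : ∀ z ∈ Metric.ball z₀ ρ, ‖A z‖ ≤ C)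
    (hM : ∀ z ∈ Metric.ball z₀ ρ, HasFDerivAt M ((A z).flip (M z)) z) (h0 : M z₀ = 0) :
    ∀ z ∈ Metric.ball z₀ ρ, M z = 0 := by
  intro z hz
  have hray : ∀ t ∈ Set.Icc (0 : ℝ) 1, z₀ + t • (z - z₀) ∈ Metric.ball z₀ ρ := by
    intro t ht
    rw [mem_ball_iff_norm] at hz ⊢
    rw [add_sub_cancel_left, norm_smul, Real.norm_of_nonneg ht.1]
    exact (mul_le_of_le_one_left (norm_nonneg _) ht.2).trans_lt hz
  have := eq_zero_of_hasDerivWithinAt_Icc (y := fun t : ℝ => M (z₀ + t • (z - z₀)))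
    (K := C * ‖z - z₀‖)
    (y' := fun t => A (z₀ + t • (z - z₀)) (z - z₀) (M (z₀ + t • (z - z₀)))) ?_ (by simp [h0]) ?_
    1 (by simp)
  · simpa using this
  · intro t ht
    have hl : HasDerivWithinAt (fun t : ℝ => z₀ + t • (z - z₀)) (z - z₀) (Set.Icc 0 1) t := by
      simpa using (((hasDerivAt_id t).smul_const (z - z₀)).const_add z₀).hasDerivWithinAt
    exact (hM _ (hray t ht)).comp_hasDerivWithinAt t hl
  · intro t ht
    exact (ContinuousLinearMap.le_opNorm₂ _ _ _).trans (by gcongr; exact hC _ (hray t ht))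

end FlatSections

/-! ### Growth and stabilization of an increasing sequence of semicontinuous ranks -/

section RankCombinatorics

/-- A bounded, lower semicontinuous, integer-valued function is constant near a point where it
attains its maximum; the functions are treated one after another on shrinking open sets. -/
theorem exists_open_ranks_constant {X : Type*} [TopologicalSpace X] {ρ : ℕ → X → ℕ} {N : ℕ}
    {D : Set X} (hN : ∀ k, ∀ z ∈ D, ρ k z ≤ N)
    (hlsc : ∀ k, ∀ z ∈ D, ∀ᶠ z' in 𝓝 z, ρ k z ≤ ρ k z') (n : ℕ) :
    ∀ D₁ ⊆ D, IsOpen D₁ → D₁.Nonempty → ∃ D₂ ⊆ D₁, IsOpen D₂ ∧ D₂.Nonempty ∧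
      ∀ j < n, ∃ r, ∀ z ∈ D₂, ρ j z = r := by
  induction n with
  | zero => exact fun D₁ _ ho hne => ⟨D₁, subset_rfl, ho, hne, by simp⟩
  | succ n ih =>
    intro D₁ hD₁ ho hne
    obtain ⟨D₂, hsub, ho₂, hne₂, hr⟩ := ih D₁ hD₁ ho hne
    have hbdd : BddAbove (ρ n '' D₂) := ⟨N, by
      rintro _ ⟨z, hz, rfl⟩
      exact hN n z (hD₁ (hsub hz))⟩
    obtain ⟨z, hz, hmax⟩ := Nat.sSup_mem (hne₂.image _) hbdd
    obtain ⟨T, hT, hTo, hzT⟩ := eventually_nhds_iff.1 (hlsc n z (hD₁ (hsub hz)))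
    refine ⟨D₂ ∩ T, Set.inter_subset_left.trans hsub, ho₂.inter hTo, ⟨z, hz, hzT⟩, ?_⟩
    intro j hj
    rcases Nat.lt_succ_iff_lt_or_eq.1 hj with hj | rfl
    · obtain ⟨r, hr⟩ := hr j hj
      exact ⟨r, fun z hz => hr z hz.1⟩
    · refine ⟨ρ j z, fun z' hz' => le_antisymm ?_ (hT z' hz'.2)⟩
      rw [hmax]
      exact le_csSup hbdd ⟨z', hz'.1, rfl⟩

theorem rank_stable {X : Type*} [TopologicalSpace X] {ρ : ℕ → X → ℕ} {D : Set X}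
    (hstab : ∀ D' ⊆ D, IsOpen D' → ∀ k r, (∀ z ∈ D', ρ k z = r) → (∀ z ∈ D', ρ (k + 1) z = r) →
      ∀ z ∈ D', ρ (k + 2) z = r)
    {k r : ℕ} {D' : Set X} (hD' : D' ⊆ D) (ho : IsOpen D') (h0 : ∀ z ∈ D', ρ k z = r)
    (h1 : ∀ z ∈ D', ρ (k + 1) z = r) (i : ℕ) : ∀ z ∈ D', ρ (k + i) z = r := by
  suffices h : (∀ z ∈ D', ρ (k + i) z = r) ∧ ∀ z ∈ D', ρ (k + i + 1) z = r from h.1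
  induction i with
  | zero => exact ⟨h0, h1⟩
  | succ i ih => exact ⟨ih.2, hstab D' hD' ho _ r ih.1 ih.2⟩

/-- A jump at step `k + 1` persists on an open set by semicontinuity, and this set can be shrunk
until `ρ 0, …, ρ k` are constant. If two consecutive ones agree, stability forbids the jump.
Otherwise they increase strictly, so `ρ k ≥ k ≥ N`, which leaves no room for a jump. -/
theorem rank_succ_eq_of_le {X : Type*} [TopologicalSpace X] {ρ : ℕ → X → ℕ} {N : ℕ}
    {D : Set X} (hD : IsOpen D) (hN : ∀ k, ∀ z ∈ D, ρ k z ≤ N)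
    (hmono : ∀ k, ∀ z ∈ D, ρ k z ≤ ρ (k + 1) z)
    (hlsc : ∀ k, ∀ z ∈ D, ∀ᶠ z' in 𝓝 z, ρ k z ≤ ρ k z')
    (hstab : ∀ D' ⊆ D, IsOpen D' → ∀ k r, (∀ z ∈ D', ρ k z = r) → (∀ z ∈ D', ρ (k + 1) z = r) →
      ∀ z ∈ D', ρ (k + 2) z = r)
    {k r : ℕ} (hk : N ≤ k) (hr : ∀ z ∈ D, ρ k z = r) : ∀ z ∈ D, ρ (k + 1) z = r := by
  intro z₁ hz₁
  by_contra hne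
  have hgt : r < ρ (k + 1) z₁ :=
    lt_of_le_of_ne ((hr z₁ hz₁).symm.le.trans (hmono k z₁ hz₁)) (Ne.symm hne)
  obtain ⟨T, hT, hTo, hzT⟩ := eventually_nhds_iff.1 (hlsc (k + 1) z₁ hz₁)
  obtain ⟨D₂, hsub, ho₂, ⟨z, hz⟩, hconst⟩ := exists_open_ranks_constant hN hlsc (k + 1) (D ∩ T)
    Set.inter_subset_left (hD.inter hTo) ⟨z₁, hz₁, hzT⟩
  have hsubD : D₂ ⊆ D := hsub.trans Set.inter_subset_left
  have hgtz : r < ρ (k + 1) z := hgt.trans_le (hT z (hsub hz).2)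
  by_cases hex : ∃ j < k, ρ j z = ρ (j + 1) z
  · obtain ⟨j, hj, he⟩ := hex
    obtain ⟨r₁, hr₁⟩ := hconst j (by omega)
    obtain ⟨r₂, hr₂⟩ := hconst (j + 1) (by omega)
    have hrr : r₂ = r₁ := by rw [← hr₁ z hz, ← hr₂ z hz, he]
    subst hrr
    have hs := rank_stable hstab hsubD ho₂ hr₁ hr₂
    have ha := hs (k - j) z hz
    have hb := hs (k + 1 - j) z hz
    rw [show j + (k - j) = k by omega, hr z (hsubD hz)] at ha
    rw [show j + (k + 1 - j) = k + 1 by omega] at hb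
    omega
  · push Not at hex
    have hlow : ∀ j ≤ k, j ≤ ρ j z := by
      intro j
      induction j with
      | zero => simp
      | succ j ih =>
        intro hj
        have h1 := ih (by omega)
        have h2 := hmono j z (hsubD hz)
        have h3 := hex j (by omega)
        omega
    have h1 := hlow k le_rfl
    have h2 := hN (k + 1) z (hsubD hz)
    have h3 := hr z (hsubD hz)
    omega

end RankCombinatorics

variable {m : ℕ}

/-! ### Partial derivatives on jet space -/

section PartialDerivatives

theorem pd_eqOn {U : Set (Jet m)} (hU : IsOpen U) {g g' : Jet m → ℝ} (h : Set.EqOn g g' U)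
    (v : Jet m) : Set.EqOn (pd v g) (pd v g') U := by
  intro j hj
  have : g =ᶠ[𝓝 j] g' := h.eventuallyEq_of_mem (hU.mem_nhds hj)
  rw [pd, pd, this.fderiv_eq]

theorem contDiffOn_pd {U : Set (Jet m)} (hU : IsOpen U) {g : Jet m → ℝ}
    (h : ContDiffOn ℝ ∞ g U) (v : Jet m) : ContDiffOn ℝ ∞ (pd v g) U :=
  (h.fderiv_of_isOpen hU (m := ∞) (by simp)).clm_apply contDiffOn_const

theorem pd_eq_of_hasDerivAt {g : Jet m → ℝ} {j v : Jet m} {d : ℝ} (hg : DifferentiableAt ℝ g j)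
    (h : HasDerivAt (fun t : ℝ => g (j + t • v)) d 0) : pd v g j = d := by
  have h1 : HasDerivAt (fun t : ℝ => g (j + t • v)) (fderiv ℝ g j v) 0 := by
    have hl : HasDerivAt (fun t : ℝ => j + t • v) v 0 := by
      simpa using ((hasDerivAt_id (0 : ℝ)).smul_const v).const_add j
    exact hg.hasFDerivAt.comp_hasDerivAt_of_eq (0 : ℝ) hl (by simp)
  exact h1.unique h

end PartialDerivatives

/-! ### Dependence of the invariants on `f` only through its values on `U` -/

section Congruence

variable {f f' : Fin m → Jet m → ℝ} {U : Set (Jet m)}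

theorem H_congr (hU : IsOpen U) (h : ∀ α, Set.EqOn (f α) (f' α) U) (γ α : Fin m) {j : Jet m}
    (hj : j ∈ U) (a : Fin m → ℝ) : H f γ α j a = H f' γ α j a := by
  have h1 := fun v α => pd_eqOn hU (h α) v hj
  have h2 := fun v w α => pd_eqOn hU (pd_eqOn hU (h α) v) w hj
  simp only [H, h1, h2, fun α => h α hj]

theorem K_congr (hU : IsOpen U) (h : ∀ α, Set.EqOn (f α) (f' α) U) (γ α : Fin m) {j : Jet m}
    (hj : j ∈ U) (a : Fin m → ℝ) : K f γ α j a = K f' γ α j a := by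
  have h1 := fun v α => pd_eqOn hU (h α) v hj
  have h2 := fun v w α => pd_eqOn hU (pd_eqOn hU (h α) v) w hj
  simp only [K, h1, h2, fun α => h α hj]

theorem S_congr (hU : IsOpen U) (h : ∀ α, Set.EqOn (f α) (f' α) U) (γ α β : Fin m) {j : Jet m}
    (hj : j ∈ U) : S f γ α β j = S f' γ α β j := by
  have h2 := fun v w α => pd_eqOn hU (pd_eqOn hU (h α) v) w hj
  simp only [S, h2]

theorem algHK_congr (hU : IsOpen U) (h : ∀ α, Set.EqOn (f α) (f' α) U) (M : Sym2 (Fin m) → ℝ)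
    (α β : Fin m) {j : Jet m} (hj : j ∈ U) (a b : Fin m → ℝ) :
    algHK f M α β j a b = algHK f' M α β j a b := by
  simp only [algHK, fun γ α => H_congr hU h γ α hj, fun γ α => K_congr hU h γ α hj]

theorem algS_congr (hU : IsOpen U) (h : ∀ α, Set.EqOn (f α) (f' α) U) (M : Sym2 (Fin m) → ℝ)
    (α β γ : Fin m) {j : Jet m} (hj : j ∈ U) : algS f M α β γ j = algS f' M α β γ j := by
  simp only [algS, fun γ α β => S_congr hU h γ α β hj]

theorem algRowValue_congr (hU : IsOpen U) (h : ∀ α, Set.EqOn (f α) (f' α) U)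
    (M : Sym2 (Fin m) → ℝ) (a : AlgRow m) :
    Set.EqOn (algRowValue f M a) (algRowValue f' M a) U := by
  have hk : ∀ α β, Set.EqOn (fun j => algHK f M α β j 0 0) (fun j => algHK f' M α β j 0 0) U :=
    fun α β j hj => algHK_congr hU h M α β hj 0 0
  cases a with
  | hk α β => exact hk α β
  | hkP α β σ => exact pd_eqOn hU (hk α β) _
  | hkQ α β τ => exact pd_eqOn hU (hk α β) _
  | hkPQ α β σ τ => exact pd_eqOn hU (pd_eqOn hU (hk α β) _) _
  | s α β γ => exact fun j hj => algS_congr hU h M α β γ hj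

/-- Permits replacing `f`, controlled only on `U`, by `rhs c`, which has the normal form on entire
fibres. -/
theorem Phi_congr (hU : IsOpen U) (h : ∀ α, Set.EqOn (f α) (f' α) U) (c : Coeffs m) (k : ℕ)
    (a : RowIdx m k) (e : Sym2 (Fin m)) :
    Set.EqOn (fun j => Phi f c k j a e) (fun j => Phi f' c k j a e) U := by
  induction k generalizing e with
  | zero => exact algRowValue_congr hU h _ a
  | succ k ih =>
    intro j hj
    rcases a with a | ⟨a, d⟩
    · exact ih a e hj
    · have h1 := pd_eqOn hU (ih a e) (d.vec, 0, 0) hj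
      have h2 : ∀ e', Phi f c k j a e' = Phi f' c k j a e' := fun e' => ih a e' hj
      simp only [Phi, Matrix.fromRows_apply_inr, Matrix.of_apply, h1, h2]

end Congruence

/-! ### The normal form and the smoothness of its coefficients -/

section NormalForm

/-- A function which is affine in `u_x` and in `u_y`. -/
def biaff (C : Fin m → Fin m → Base m → ℝ) (A B : Fin m → Base m → ℝ) (E : Base m → ℝ)
    (j : Jet m) : ℝ :=
  ∑ β, ∑ γ, C β γ j.1 * (j.2.1 β * j.2.2 γ) + ∑ γ, A γ j.1 * j.2.1 γ + ∑ γ, B γ j.1 * j.2.2 γ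
    + E j.1

variable {C : Fin m → Fin m → Base m → ℝ} {A B : Fin m → Base m → ℝ} {E : Base m → ℝ}

theorem pd_biaff {j : Jet m} (hC : ∀ β γ, DifferentiableAt ℝ (C β γ) j.1)
    (hA : ∀ γ, DifferentiableAt ℝ (A γ) j.1) (hB : ∀ γ, DifferentiableAt ℝ (B γ) j.1)
    (hE : DifferentiableAt ℝ E j.1) (v : Jet m) :
    pd v (biaff C A B E) j =
      ∑ β, ∑ γ, (fderiv ℝ (C β γ) j.1 v.1 * (j.2.1 β * j.2.2 γ) +
        C β γ j.1 * (v.2.1 β * j.2.2 γ + j.2.1 β * v.2.2 γ)) +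
      ∑ γ, (fderiv ℝ (A γ) j.1 v.1 * j.2.1 γ + A γ j.1 * v.2.1 γ) +
      ∑ γ, (fderiv ℝ (B γ) j.1 v.1 * j.2.2 γ + B γ j.1 * v.2.2 γ) + fderiv ℝ E j.1 v.1 := by
  have hbase : ∀ {g : Base m → ℝ}, DifferentiableAt ℝ g j.1 →
      DifferentiableAt ℝ (fun j' : Jet m => g j'.1) j := fun hg =>
    hg.comp (f := fun j' : Jet m => j'.1) j differentiableAt_fst
  refine pd_eq_of_hasDerivAt ?_ ?_
  · have := fun β γ => hbase (hC β γ)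
    have := fun γ => hbase (hA γ)
    have := fun γ => hbase (hB γ)
    have := hbase hE
    unfold biaff
    fun_prop
  · have hl : HasDerivAt (fun t : ℝ => (j + t • v).1) v.1 0 := by
      simpa using ((hasDerivAt_id (0 : ℝ)).smul_const v.1).const_add j.1
    have hb : ∀ {g : Base m → ℝ}, DifferentiableAt ℝ g j.1 →
        HasDerivAt (fun t : ℝ => g (j + t • v).1) (fderiv ℝ g j.1 v.1) 0 := fun hg =>
      hg.hasFDerivAt.comp_hasDerivAt_of_eq (0 : ℝ) hl (by simp)
    have hp : ∀ β, HasDerivAt (fun t : ℝ => (j + t • v).2.1 β) (v.2.1 β) 0 := fun β => by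
      simpa using ((hasDerivAt_id (0 : ℝ)).mul_const (v.2.1 β)).const_add (j.2.1 β)
    have hq : ∀ β, HasDerivAt (fun t : ℝ => (j + t • v).2.2 β) (v.2.2 β) 0 := fun β => by
      simpa using ((hasDerivAt_id (0 : ℝ)).mul_const (v.2.2 β)).const_add (j.2.2 β)
    have h1 := HasDerivAt.fun_sum (u := Finset.univ) fun β _ =>
      HasDerivAt.fun_sum (u := Finset.univ) fun γ _ => (hb (hC β γ)).fun_mul ((hp β).fun_mul (hq γ))
    have h2 := HasDerivAt.fun_sum (u := Finset.univ) fun γ _ => (hb (hA γ)).fun_mul (hp γ)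
    have h3 := HasDerivAt.fun_sum (u := Finset.univ) fun γ _ => (hb (hB γ)).fun_mul (hq γ)
    simpa [biaff] using ((h1.fun_add h2).fun_add h3).fun_add (hb hE)

/-- The right-hand sides of the system in normal form, as functions of all jets. -/
def rhs (c : Coeffs m) (α : Fin m) : Jet m → ℝ :=
  biaff (fun β γ z => -c.C α β γ z) (fun γ z => -c.A α γ z) (fun γ z => -c.B α γ z)
    (fun z => -c.E α z)

theorem HasNormalForm.eqOn_rhs {f : Fin m → Jet m → ℝ} {c : Coeffs m} {U : Set (Jet m)}
    (h : HasNormalForm f c U) (α : Fin m) : Set.EqOn (f α) (rhs c α) U := by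
  intro j hj
  have := h j hj α
  simp only [rhs, biaff, neg_mul, Finset.sum_neg_distrib, ← mul_assoc]
  linarith

/-- The coefficients of the normal form are smooth on `O`. -/
structure Coeffs.SmoothOn (c : Coeffs m) (O : Set (Base m)) : Prop where
  C : ∀ α β γ, ContDiffOn ℝ ∞ (c.C α β γ) O
  A : ∀ α γ, ContDiffOn ℝ ∞ (c.A α γ) O
  B : ∀ α γ, ContDiffOn ℝ ∞ (c.B α γ) O
  E : ∀ α, ContDiffOn ℝ ∞ (c.E α) O

/-- The coefficients are finite differences of `f` in the fibre: `C` is a mixed second difference,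
`A` and `B` are first differences corrected by `C`, and `E` is what remains. Each inherits
smoothness from `f`. -/
theorem HasNormalForm.smoothOn {f : Fin m → Jet m → ℝ} {c : Coeffs m} {U : Set (Jet m)}
    (h : HasNormalForm f c U) (hU : IsOpen U) (hf : ∀ α, ContDiffOn ℝ ∞ (f α) U) :
    c.SmoothOn (Prod.fst '' U) := by
  have key : ∀ j ∈ U, ∀ α, ContDiffAt ℝ ∞ (fun z => rhs c α (z, j.2)) j.1 := by
    intro j hj α
    have h1 : ContDiffAt ℝ ∞ (f α) j := (hf α).contDiffAt (hU.mem_nhds hj)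
    have h2 : ContDiffAt ℝ ∞ (rhs c α) (j.1, j.2) :=
      h1.congr_of_eventuallyEq ((h.eqOn_rhs α).symm.eventuallyEq_of_mem (hU.mem_nhds hj))
    exact h2.comp (f := fun z => (z, j.2)) j.1 (contDiffAt_id.prodMk contDiffAt_const)
  -- The step is chosen so small that all points of the difference quotients stay in `U`, where `rhs
  -- c` agrees with the smooth `f`.
  have hε : ∀ j ∈ U, ∀ β γ : Fin m, ∃ ε : ℝ, ε ≠ 0 ∧
      (j.1, j.2.1 + ε • Pi.single β (1 : ℝ), j.2.2) ∈ U ∧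
      (j.1, j.2.1, j.2.2 + ε • Pi.single γ (1 : ℝ)) ∈ U ∧
      (j.1, j.2.1 + ε • Pi.single β (1 : ℝ), j.2.2 + ε • Pi.single γ (1 : ℝ)) ∈ U := by
    intro j hj β γ
    have hev : ∀ g : ℝ → Jet m, Continuous g → g 0 = j → ∀ᶠ ε in 𝓝[≠] (0 : ℝ), g ε ∈ U := by
      intro g hg h0
      refine (hg.tendsto 0).eventually (hU.mem_nhds (by rwa [h0])) |>.filter_mono
        nhdsWithin_le_nhds
    have h1 := hev (fun ε => (j.1, j.2.1 + ε • Pi.single β (1 : ℝ), j.2.2)) (by fun_prop) (by simp)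
    have h2 := hev (fun ε => (j.1, j.2.1, j.2.2 + ε • Pi.single γ (1 : ℝ))) (by fun_prop) (by simp)
    have h3 := hev (fun ε => (j.1, j.2.1 + ε • Pi.single β (1 : ℝ),
      j.2.2 + ε • Pi.single γ (1 : ℝ))) (by fun_prop) (by simp)
    obtain ⟨ε, hε⟩ := ((h1.and (h2.and h3)).and self_mem_nhdsWithin).exists
    exact ⟨ε, hε.2, hε.1.1, hε.1.2.1, hε.1.2.2⟩
  have hC : ∀ j ∈ U, ∀ α β γ, ContDiffAt ℝ ∞ (c.C α β γ) j.1 := by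
    intro j hj α β γ
    obtain ⟨ε, hε0, h1, h2, h3⟩ := hε j hj β γ
    have e : c.C α β γ = fun z => -(ε⁻¹ * ε⁻¹) *
        (rhs c α (z, j.2.1 + ε • Pi.single β (1 : ℝ), j.2.2 + ε • Pi.single γ (1 : ℝ))
          - rhs c α (z, j.2.1 + ε • Pi.single β (1 : ℝ), j.2.2)
          - rhs c α (z, j.2.1, j.2.2 + ε • Pi.single γ (1 : ℝ)) + rhs c α (z, j.2)) := by
      funext z
      simp [rhs, biaff, mul_add, add_mul, Finset.sum_add_distrib, Pi.single_apply]
      field_simp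
      ring
    rw [e]
    exact contDiffAt_const.mul ((((key _ h3 α).sub (key _ h1 α)).sub (key _ h2 α)).add (key _ hj α))
  have hA : ∀ j ∈ U, ∀ α γ, ContDiffAt ℝ ∞ (c.A α γ) j.1 := by
    intro j hj α γ
    obtain ⟨ε, hε0, h1, h2, h3⟩ := hε j hj γ γ
    have e : c.A α γ = fun z => -ε⁻¹ *
        (rhs c α (z, j.2.1 + ε • Pi.single γ (1 : ℝ), j.2.2) - rhs c α (z, j.2))
          - ∑ τ, c.C α γ τ z * j.2.2 τ := by
      funext z
      simp [rhs, biaff, mul_add, add_mul, Finset.sum_add_distrib, Pi.single_apply,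
        mul_left_comm _ ε, ← Finset.mul_sum]
      field_simp
      ring
    rw [e]
    exact (contDiffAt_const.mul ((key _ h1 α).sub (key _ hj α))).sub
      (ContDiffAt.sum fun τ _ => (hC j hj α γ τ).mul contDiffAt_const)
  have hB : ∀ j ∈ U, ∀ α γ, ContDiffAt ℝ ∞ (c.B α γ) j.1 := by
    intro j hj α γ
    obtain ⟨ε, hε0, h1, h2, h3⟩ := hε j hj γ γ
    have e : c.B α γ = fun z => -ε⁻¹ *
        (rhs c α (z, j.2.1, j.2.2 + ε • Pi.single γ (1 : ℝ)) - rhs c α (z, j.2))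
          - ∑ τ, c.C α τ γ z * j.2.1 τ := by
      funext z
      simp [rhs, biaff, mul_add, Finset.sum_add_distrib, Pi.single_apply]
      field_simp
      simp only [mul_comm _ ε, mul_assoc, ← Finset.mul_sum]
      ring
    rw [e]
    exact (contDiffAt_const.mul ((key _ h2 α).sub (key _ hj α))).sub
      (ContDiffAt.sum fun τ _ => (hC j hj α τ γ).mul contDiffAt_const)
  have hE : ∀ j ∈ U, ∀ α, ContDiffAt ℝ ∞ (c.E α) j.1 := by
    intro j hj α
    have e : c.E α = fun z => -(rhs c α (z, j.2) + ∑ β, ∑ γ, c.C α β γ z * (j.2.1 β * j.2.2 γ)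
        + ∑ γ, c.A α γ z * j.2.1 γ + ∑ γ, c.B α γ z * j.2.2 γ) := by
      funext z
      simp [rhs, biaff]
      ring
    rw [e]
    exact (((key _ hj α).add (ContDiffAt.sum fun β _ => ContDiffAt.sum fun γ _ =>
      (hC j hj α β γ).mul contDiffAt_const)).add (ContDiffAt.sum fun γ _ =>
      (hA j hj α γ).mul contDiffAt_const)).add (ContDiffAt.sum fun γ _ =>
      (hB j hj α γ).mul contDiffAt_const) |>.neg
  constructor
  · rintro α β γ _ ⟨j, hj, rfl⟩
    exact (hC j hj α β γ).contDiffWithinAt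
  · rintro α γ _ ⟨j, hj, rfl⟩
    exact (hA j hj α γ).contDiffWithinAt
  · rintro α γ _ ⟨j, hj, rfl⟩
    exact (hB j hj α γ).contDiffWithinAt
  · rintro α _ ⟨j, hj, rfl⟩
    exact (hE j hj α).contDiffWithinAt

end NormalForm

variable {c : Coeffs m} {O : Set (Base m)}

/-! ### `H`, `K` and `S` in terms of the coefficients -/

section Formulas

theorem isOpen_fst_preimage (hO : IsOpen O) : IsOpen {j : Jet m | j.1 ∈ O} :=
  hO.preimage continuous_fst

namespace Coeffs.SmoothOn

theorem differentiableAt_C (hc : c.SmoothOn O) (hO : IsOpen O) {z : Base m} (hz : z ∈ O)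
    (α β γ : Fin m) : DifferentiableAt ℝ (c.C α β γ) z :=
  ((hc.C α β γ).contDiffAt (hO.mem_nhds hz)).differentiableAt (by simp)

theorem differentiableAt_A (hc : c.SmoothOn O) (hO : IsOpen O) {z : Base m} (hz : z ∈ O)
    (α γ : Fin m) : DifferentiableAt ℝ (c.A α γ) z :=
  ((hc.A α γ).contDiffAt (hO.mem_nhds hz)).differentiableAt (by simp)

theorem differentiableAt_B (hc : c.SmoothOn O) (hO : IsOpen O) {z : Base m} (hz : z ∈ O)
    (α γ : Fin m) : DifferentiableAt ℝ (c.B α γ) z :=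
  ((hc.B α γ).contDiffAt (hO.mem_nhds hz)).differentiableAt (by simp)

theorem differentiableAt_E (hc : c.SmoothOn O) (hO : IsOpen O) {z : Base m} (hz : z ∈ O)
    (α : Fin m) : DifferentiableAt ℝ (c.E α) z :=
  ((hc.E α).contDiffAt (hO.mem_nhds hz)).differentiableAt (by simp)

end Coeffs.SmoothOn

/-- The matrix `Ω^σ_β (∂/∂y + q^τ ∂/∂u^τ)`. -/
def aMat (c : Coeffs m) (z : Base m) (q : Fin m → ℝ) : Matrix (Fin m) (Fin m) ℝ :=
  Matrix.of fun σ β => ∑ τ, c.C σ β τ z * q τ + c.A σ β z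

/-- The matrix `-∂f^σ/∂u_y^β`. -/
def bMat (c : Coeffs m) (z : Base m) (p : Fin m → ℝ) : Matrix (Fin m) (Fin m) ℝ :=
  Matrix.of fun σ β => ∑ τ, c.C σ τ β z * p τ + c.B σ β z

/-- The vector `∂/∂x + p^τ ∂/∂u^τ`. -/
def vecX (p : Fin m → ℝ) : Base m := (1, 0, p)

/-- The vector `∂/∂y + q^τ ∂/∂u^τ`. -/
def vecY (q : Fin m → ℝ) : Base m := (0, 1, q)

theorem apply_vecX (L : Base m →L[ℝ] ℝ) (p : Fin m → ℝ) :
    L (vecX p) = L (1, 0, 0) + ∑ β, L (0, 0, Pi.single β 1) * p β := by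
  have : vecX p = (1, 0, 0) + ∑ β, p β • ((0, 0, Pi.single β 1) : Base m) := by
    refine Prod.ext ?_ (Prod.ext ?_ ?_)
    · simp [vecX, Prod.fst_sum]
    · simp [vecX, Prod.fst_sum, Prod.snd_sum]
    · ext i
      simp [vecX, Prod.snd_sum, Finset.sum_apply, Pi.single_apply]
  rw [this, map_add, map_sum]
  simp only [map_smul, smul_eq_mul, mul_comm]

theorem apply_vecY (L : Base m →L[ℝ] ℝ) (q : Fin m → ℝ) :
    L (vecY q) = L (0, 1, 0) + ∑ β, L (0, 0, Pi.single β 1) * q β := by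
  have : vecY q = (0, 1, 0) + ∑ β, q β • ((0, 0, Pi.single β 1) : Base m) := by
    refine Prod.ext ?_ (Prod.ext ?_ ?_)
    · simp [vecY, Prod.fst_sum]
    · simp [vecY, Prod.fst_sum, Prod.snd_sum]
    · ext i
      simp [vecY, Prod.snd_sum, Finset.sum_apply, Pi.single_apply]
  rw [this, map_add, map_sum]
  simp only [map_smul, smul_eq_mul, mul_comm]

variable (hc : c.SmoothOn O) (hO : IsOpen O)
include hc hO

theorem pd_rhs {j : Jet m} (hj : j.1 ∈ O) (α : Fin m) (v : Jet m) :
    pd v (rhs c α) j =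
      ∑ β, ∑ γ, (-fderiv ℝ (c.C α β γ) j.1 v.1 * (j.2.1 β * j.2.2 γ) -
        c.C α β γ j.1 * (v.2.1 β * j.2.2 γ + j.2.1 β * v.2.2 γ)) +
      ∑ γ, (-fderiv ℝ (c.A α γ) j.1 v.1 * j.2.1 γ - c.A α γ j.1 * v.2.1 γ) +
      ∑ γ, (-fderiv ℝ (c.B α γ) j.1 v.1 * j.2.2 γ - c.B α γ j.1 * v.2.2 γ)
        - fderiv ℝ (c.E α) j.1 v.1 := by
  refine (pd_biaff (fun β γ => (hc.differentiableAt_C hO hj α β γ).fun_neg)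
    (fun γ => (hc.differentiableAt_A hO hj α γ).fun_neg)
    (fun γ => (hc.differentiableAt_B hO hj α γ).fun_neg)
    (hc.differentiableAt_E hO hj α).fun_neg v).trans ?_
  simp only [fderiv_fun_neg, _root_.neg_apply, neg_mul, sub_eq_add_neg]

theorem pd_eP_rhs (α δ : Fin m) : Set.EqOn (pd (eP δ) (rhs c α))
    (biaff 0 0 (fun γ z => -c.C α δ γ z) (fun z => -c.A α δ z)) {j | j.1 ∈ O} := by
  intro j hj
  rw [pd_rhs hc hO hj]
  simp [eP, biaff, Prod.mk_zero_zero, Pi.single_apply, ← sub_eq_add_neg]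

theorem pd_eQ_rhs (α δ : Fin m) : Set.EqOn (pd (eQ δ) (rhs c α))
    (biaff 0 (fun γ z => -c.C α γ δ z) 0 (fun z => -c.B α δ z)) {j | j.1 ∈ O} := by
  intro j hj
  rw [pd_rhs hc hO hj]
  simp [eQ, biaff, Prod.mk_zero_zero, Pi.single_apply, ← sub_eq_add_neg]

theorem pd_pd_eP_rhs {j : Jet m} (hj : j.1 ∈ O) (α δ : Fin m) (v : Jet m) :
    pd v (pd (eP δ) (rhs c α)) j =
      -(∑ γ, (fderiv ℝ (c.C α δ γ) j.1 v.1 * j.2.2 γ + c.C α δ γ j.1 * v.2.2 γ)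
        + fderiv ℝ (c.A α δ) j.1 v.1) := by
  rw [pd_eqOn (isOpen_fst_preimage hO) (pd_eP_rhs hc hO α δ) v hj]
  refine (pd_biaff (fun _ _ => differentiableAt_const 0) (fun _ => differentiableAt_const 0)
    (fun γ => (hc.differentiableAt_C hO hj α δ γ).fun_neg)
    (hc.differentiableAt_A hO hj α δ).fun_neg v).trans ?_
  simp [Finset.sum_add_distrib]
  ring

theorem pd_pd_eQ_rhs {j : Jet m} (hj : j.1 ∈ O) (α δ : Fin m) (v : Jet m) :
    pd v (pd (eQ δ) (rhs c α)) j =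
      -(∑ γ, (fderiv ℝ (c.C α γ δ) j.1 v.1 * j.2.1 γ + c.C α γ δ j.1 * v.2.1 γ)
        + fderiv ℝ (c.B α δ) j.1 v.1) := by
  rw [pd_eqOn (isOpen_fst_preimage hO) (pd_eQ_rhs hc hO α δ) v hj]
  refine (pd_biaff (fun _ _ => differentiableAt_const 0)
    (fun γ => (hc.differentiableAt_C hO hj α γ δ).fun_neg) (fun _ => differentiableAt_const 0)
    (hc.differentiableAt_B hO hj α δ).fun_neg v).trans ?_
  simp [Finset.sum_add_distrib]
  ring

/-- `f_u`, the common part of `H` and `K`, is affine in `u_x` and in `u_y`. -/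
theorem pd_eU_rhs {j : Jet m} (hj : j.1 ∈ O) (γ α : Fin m) : pd (eU α) (rhs c γ) j =
    -(∑ β, ∑ τ, fderiv ℝ (c.C γ β τ) j.1 (eU α : Jet m).1 * (j.2.1 β * j.2.2 τ)
      + ∑ τ, fderiv ℝ (c.A γ τ) j.1 (eU α : Jet m).1 * j.2.1 τ
      + ∑ τ, fderiv ℝ (c.B γ τ) j.1 (eU α : Jet m).1 * j.2.2 τ
      + fderiv ℝ (c.E γ) j.1 (eU α : Jet m).1) := by
  rw [pd_rhs hc hO hj]
  simp [eU]
  ring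

/-- The argument `a`, standing for `u_xx`, drops out because `f` is affine in `u_x`. The last sum
comes from `D_x` acting on `u_y`, which gives `f`. -/
theorem H_rhs {j : Jet m} (hj : j.1 ∈ O) (γ α : Fin m) (a : Fin m → ℝ) :
    H (rhs c) γ α j a = pd (eU α) (rhs c γ) j + (bMat c j.1 j.2.1 * aMat c j.1 j.2.2) γ α
      + (∑ τ, fderiv ℝ (c.C γ α τ) j.1 (vecX j.2.1) * j.2.2 τ
        + fderiv ℝ (c.A γ α) j.1 (vecX j.2.1)) + ∑ β, c.C γ α β j.1 * rhs c β j := by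
  have h1 : ∀ σ, pd (eQ σ) (rhs c γ) j = -bMat c j.1 j.2.1 γ σ := fun σ => by
    rw [pd_eQ_rhs hc hO γ σ hj]; simp [biaff, bMat]; ring
  have h2 : ∀ σ, pd (eP α) (rhs c σ) j = -aMat c j.1 j.2.2 σ α := fun σ => by
    rw [pd_eP_rhs hc hO σ α hj]; simp [biaff, aMat]; ring
  simp only [H, h1, h2, pd_pd_eP_rhs hc hO hj, Matrix.mul_apply, apply_vecX]
  simp [eX, eU, eQ, eP, Prod.mk_zero_zero, Pi.single_apply, Finset.sum_add_distrib, add_mul,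
    Finset.sum_mul]
  rw [Finset.sum_comm]
  simp only [mul_right_comm]
  ring

theorem K_rhs {j : Jet m} (hj : j.1 ∈ O) (γ α : Fin m) (a : Fin m → ℝ) :
    K (rhs c) γ α j a = pd (eU α) (rhs c γ) j + (aMat c j.1 j.2.2 * bMat c j.1 j.2.1) γ α
      + (∑ τ, fderiv ℝ (c.C γ τ α) j.1 (vecY j.2.2) * j.2.1 τ
        + fderiv ℝ (c.B γ α) j.1 (vecY j.2.2)) + ∑ β, c.C γ β α j.1 * rhs c β j := by
  have h1 : ∀ σ, pd (eQ α) (rhs c σ) j = -bMat c j.1 j.2.1 σ α := fun σ => by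
    rw [pd_eQ_rhs hc hO σ α hj]; simp [biaff, bMat]; ring
  have h2 : ∀ σ, pd (eP σ) (rhs c γ) j = -aMat c j.1 j.2.2 γ σ := fun σ => by
    rw [pd_eP_rhs hc hO γ σ hj]; simp [biaff, aMat]; ring
  simp only [K, h1, h2, pd_pd_eQ_rhs hc hO hj, Matrix.mul_apply, apply_vecY]
  simp [eY, eU, eQ, eP, Prod.mk_zero_zero, Pi.single_apply, Finset.sum_add_distrib, add_mul,
    Finset.sum_mul]
  rw [Finset.sum_comm]
  simp only [mul_right_comm]
  ring

/-- The fibre coordinates disappear, so an `S` condition holding at one jet holds on the whole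
fibre. -/
theorem S_rhs {j : Jet m} (hj : j.1 ∈ O) (γ α β : Fin m) :
    S (rhs c) γ α β j = c.C γ α β j.1 - c.C γ β α j.1 := by
  simp only [S, pd_pd_eQ_rhs hc hO hj]
  simp [eP, Prod.mk_zero_zero, Pi.single_apply]
  ring

end Formulas

/-! ### The connection on symmetric matrices and its curvature in matrix form -/

section Connection

theorem Omega_apply (c : Coeffs m) (σ α : Fin m) (z v : Base m) :
    Omega c σ α z v = ∑ τ, c.C σ α τ z * v.2.2 τ + c.A σ α z * v.2.1 + c.B σ α z * v.1 := by
  simp [Omega, dx, dy, du]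

theorem connAct_mk (c : Coeffs m) (z v : Base m) (M : Sym2 (Fin m) → ℝ) (α β : Fin m) :
    connAct c z v M s(α, β) =
      ∑ σ, (M s(α, σ) * Omega c σ β z v + M s(β, σ) * Omega c σ α z v) := by
  simp [connAct, connForm]

/-- The connection `dM_{αβ} = M_{ασ} Ω^σ_β + M_{βσ} Ω^σ_α` on symmetric matrices. -/
def connMap (c : Coeffs m) (z : Base m) :
    Base m →L[ℝ] (Sym2 (Fin m) → ℝ) →L[ℝ] (Sym2 (Fin m) → ℝ) :=
  LinearMap.toContinuousLinearMap
    { toFun := fun v => LinearMap.toContinuousLinearMap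
        { toFun := connAct c z v
          map_add' := fun M N => by
            ext e
            induction e with | _ α β
            simp only [Pi.add_apply, connAct_mk, ← Finset.sum_add_distrib]
            exact Finset.sum_congr rfl fun σ _ => by ring
          map_smul' := fun t M => by
            ext e
            induction e with | _ α β
            simp only [Pi.smul_apply, connAct_mk, smul_eq_mul, RingHom.id_apply, Finset.mul_sum]
            exact Finset.sum_congr rfl fun σ _ => by ring }
      map_add' := fun v w => by
        ext M e
        induction e with | _ α β
        change connAct c z (v + w) M s(α, β) = connAct c z v M s(α, β) + connAct c z w M s(α, β)
        simp only [connAct_mk, map_add, ← Finset.sum_add_distrib]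
        exact Finset.sum_congr rfl fun σ _ => by ring
      map_smul' := fun t v => by
        ext M e
        induction e with | _ α β
        change connAct c z (t • v) M s(α, β) = t * connAct c z v M s(α, β)
        simp only [connAct_mk, map_smul, smul_eq_mul, Finset.mul_sum]
        exact Finset.sum_congr rfl fun σ _ => by ring }

theorem connMap_apply (c : Coeffs m) (z v : Base m) (M : Sym2 (Fin m) → ℝ) :
    connMap c z v M = connAct c z v M := rfl

theorem Coeffs.SmoothOn.contDiffOn_Omega (hc : c.SmoothOn O) (σ α : Fin m) (v : Base m) :
    ContDiffOn ℝ ∞ (fun z => Omega c σ α z v) O := by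
  simp only [Omega_apply]
  exact ((ContDiffOn.sum fun τ _ => (hc.C σ α τ).mul contDiffOn_const).add
    ((hc.A σ α).mul contDiffOn_const)).add ((hc.B σ α).mul contDiffOn_const)

theorem Coeffs.SmoothOn.contDiffOn_connMap (hc : c.SmoothOn O) :
    ContDiffOn ℝ ∞ (connMap c) O := by
  refine contDiffOn_clm_apply.2 fun v => contDiffOn_clm_apply.2 fun M =>
    contDiffOn_pi.2 fun e => ?_
  induction e with | _ α β
  simp only [connMap_apply, connAct_mk]
  exact ContDiffOn.sum fun σ _ => (contDiffOn_const.mul (hc.contDiffOn_Omega σ β v)).add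
    (contDiffOn_const.mul (hc.contDiffOn_Omega σ α v))

/-- A vector indexed by unordered pairs, as a symmetric matrix. -/
def toMat (M : Sym2 (Fin m) → ℝ) : Matrix (Fin m) (Fin m) ℝ := Matrix.of fun α β => M s(α, β)

theorem toMat_apply (M : Sym2 (Fin m) → ℝ) (α β : Fin m) : toMat M α β = M s(α, β) := rfl

theorem toMat_transpose (M : Sym2 (Fin m) → ℝ) : (toMat M).transpose = toMat M := by
  ext α β
  simp [toMat, Sym2.eq_swap]

/-- The matrix `Ω^σ_β(v)`. -/
def omMat (c : Coeffs m) (z v : Base m) : Matrix (Fin m) (Fin m) ℝ :=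
  Matrix.of fun σ β => Omega c σ β z v

/-- The derivative of the matrix `Ω^σ_β(v)` in the direction `w`. -/
def dOmMat (c : Coeffs m) (z w v : Base m) : Matrix (Fin m) (Fin m) ℝ :=
  Matrix.of fun σ β => fderiv ℝ (fun z' => Omega c σ β z' v) z w

theorem toMat_connMap (c : Coeffs m) (z v : Base m) (M : Sym2 (Fin m) → ℝ) :
    toMat (connMap c z v M) = toMat M * omMat c z v + (toMat M * omMat c z v).transpose := by
  ext α β
  simp [connMap_apply, toMat_apply, connAct_mk, Matrix.mul_apply, omMat, Finset.sum_add_distrib,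
    mul_comm]

theorem toMat_fderiv_connMap (hc : c.SmoothOn O) (hO : IsOpen O) {z : Base m} (hz : z ∈ O)
    (w v : Base m) (M : Sym2 (Fin m) → ℝ) : toMat (fderiv ℝ (connMap c) z w v M) =
      toMat M * dOmMat c z w v + (toMat M * dOmMat c z w v).transpose := by
  ext α β
  have hd : DifferentiableAt ℝ (connMap c) z :=
    (hc.contDiffOn_connMap.contDiffAt (hO.mem_nhds hz)).differentiableAt (by simp)
  have hΩ : ∀ σ β, HasFDerivAt (fun z' => Omega c σ β z' v)
      (fderiv ℝ (fun z' => Omega c σ β z' v) z) z := fun σ β =>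
    (((hc.contDiffOn_Omega σ β v).contDiffAt (hO.mem_nhds hz)).differentiableAt
      (by simp)).hasFDerivAt
  have h1 := hasFDerivAt_pi'.1 ((hd.hasFDerivAt.clm_apply (hasFDerivAt_const v z)).clm_apply
    (hasFDerivAt_const M z)) s(α, β)
  have h2 := HasFDerivAt.fun_sum (u := Finset.univ) fun σ _ =>
    ((hΩ σ β).const_mul (M s(α, σ))).fun_add ((hΩ σ α).const_mul (M s(β, σ)))
  simp only [connMap_apply, connAct_mk] at h1
  have h3 := congrArg (fun L => L w) (h1.unique h2)
  simp at h3
  simp [toMat_apply, h3, Matrix.mul_apply, dOmMat, Finset.sum_add_distrib, mul_comm]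

theorem toMat_add (M N : Sym2 (Fin m) → ℝ) : toMat (M + N) = toMat M + toMat N := rfl

theorem toMat_sub (M N : Sym2 (Fin m) → ℝ) : toMat (M - N) = toMat M - toMat N := rfl

/-- The connection is induced from `Ω`, so its curvature acts through that of `Ω`. In the
commutator, terms with one factor of `Ω` on each side of `M` cancel. -/
theorem toMat_curvature (hc : c.SmoothOn O) (hO : IsOpen O) {z : Base m} (hz : z ∈ O)
    (v w : Base m) (M : Sym2 (Fin m) → ℝ) : toMat (curvature (connMap c) z v w M) =
      toMat M * (dOmMat c z w v - dOmMat c z v w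
        + (omMat c z w * omMat c z v - omMat c z v * omMat c z w)) +
      (toMat M * (dOmMat c z w v - dOmMat c z v w
        + (omMat c z w * omMat c z v - omMat c z v * omMat c z w))).transpose := by
  simp only [curvature, toMat_add, toMat_sub, toMat_fderiv_connMap hc hO hz, toMat_connMap,
    Matrix.transpose_mul, Matrix.transpose_add, Matrix.transpose_sub, toMat_transpose,
    Matrix.transpose_transpose]
  noncomm_ring

end Connection

/-! ### Curvature as a consequence of the algebraic conditions -/

section Curvature

/-- The matrix `S^σ_{βτ} p^τ`. -/
def sMat (c : Coeffs m) (z : Base m) (p : Fin m → ℝ) : Matrix (Fin m) (Fin m) ℝ :=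
  Matrix.of fun σ β => ∑ τ, (c.C σ β τ z - c.C σ τ β z) * p τ

theorem omMat_vecY (c : Coeffs m) (z : Base m) (q : Fin m → ℝ) :
    omMat c z (vecY q) = aMat c z q := by
  ext σ β
  simp [omMat, Omega_apply, vecY, aMat]

theorem omMat_vecX (c : Coeffs m) (z : Base m) (p : Fin m → ℝ) :
    omMat c z (vecX p) = bMat c z p + sMat c z p := by
  ext σ β
  simp [omMat, Omega_apply, vecX, bMat, sMat, sub_mul, Finset.sum_sub_distrib]
  ring

/-- In the application `a = Ω(Y)`, `b + s = Ω(X)` with `s` the contraction of `S` with `p`, primes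
denote derivatives along `X` (for `a`) or `Y` (for `b`, `s`), and `t` is the contraction of `S` with
`f`. Then `h1` is the symmetrized `H`-`K` condition and `h3` the covariant derivative of the `S`
condition along `Y`; the remaining terms are multiples of `hs`. -/
theorem symmetrized_curvature_eq_zero {R : Type*} [CommRing R] {n : Type*} [Fintype n]
    {M a b s a' b' s' t : Matrix n n R} (hM : M.transpose = M)
    (h1 : M * (b * a - a * b + a' - b' + t) + (M * (b * a - a * b + a' - b' + t)).transpose = 0)
    (ht : M * t + (M * t).transpose = 0) (hs : M * s + (M * s).transpose = 0)
    (h3 : (M * s' + (M * a + (M * a).transpose) * s)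
      + (M * s' + (M * a + (M * a).transpose) * s).transpose = 0) :
    M * (a' - (b' + s') + ((b + s) * a - a * (b + s))) +
      (M * (a' - (b' + s') + ((b + s) * a - a * (b + s)))).transpose = 0 := by
  have key : M * (a' - (b' + s') + ((b + s) * a - a * (b + s))) +
      (M * (a' - (b' + s') + ((b + s) * a - a * (b + s)))).transpose =
      (M * (b * a - a * b + a' - b' + t) + (M * (b * a - a * b + a' - b' + t)).transpose)
      - (M * t + (M * t).transpose)
      - ((M * s' + (M * a + (M * a).transpose) * s)
        + (M * s' + (M * a + (M * a).transpose) * s).transpose)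
      + a.transpose * (M * s + (M * s).transpose) + (M * s + (M * s).transpose) * a := by
    simp only [Matrix.transpose_mul, Matrix.transpose_add, Matrix.transpose_sub, hM,
      Matrix.transpose_transpose]
    noncomm_ring
  rw [key, h1, ht, h3, hs]
  simp

/-- The derivative of `S^σ_{βγ}` in the direction `v`, for a system in normal form. -/
def dS (c : Coeffs m) (z v : Base m) (σ β γ : Fin m) : ℝ :=
  fderiv ℝ (c.C σ β γ) z v - fderiv ℝ (c.C σ γ β) z v

variable (hc : c.SmoothOn O) (hO : IsOpen O)
include hc hO

theorem fderiv_Omega {z : Base m} (hz : z ∈ O) (σ α : Fin m) (v w : Base m) :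
    fderiv ℝ (fun z' => Omega c σ α z' v) z w = ∑ τ, fderiv ℝ (c.C σ α τ) z w * v.2.2 τ
      + fderiv ℝ (c.A σ α) z w * v.2.1 + fderiv ℝ (c.B σ α) z w * v.1 := by
  simp only [Omega_apply]
  have h := ((HasFDerivAt.fun_sum (u := Finset.univ) fun τ _ =>
    (hc.differentiableAt_C hO hz σ α τ).hasFDerivAt.mul_const (v.2.2 τ)).fun_add
    ((hc.differentiableAt_A hO hz σ α).hasFDerivAt.mul_const v.2.1)).fun_add
    ((hc.differentiableAt_B hO hz σ α).hasFDerivAt.mul_const v.1)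
  rw [h.fderiv]
  simp [mul_comm]

theorem curvature_vecY_vecX {z : Base m} (hz : z ∈ O) {M : Sym2 (Fin m) → ℝ}
    (h1 : ∀ p q α β, algHK (rhs c) M α β (z, p, q) 0 0 = 0)
    (h2 : ∀ α β γ, algS (rhs c) M α β γ (z, 0, 0) = 0)
    (h3 : ∀ v α β γ, ∑ σ, M s(α, σ) * dS c z v σ β γ + ∑ σ, M s(β, σ) * dS c z v σ α γ +
      algS (rhs c) (connMap c z v M) α β γ (z, 0, 0) = 0) (p q : Fin m → ℝ) :
    curvature (connMap c) z (vecY q) (vecX p) M = 0 := by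
  have hz0 : ((z, 0, 0) : Jet m).1 ∈ O := hz
  have hsum : ∀ (N : Matrix (Fin m) (Fin m) ℝ) (T : Fin m → Fin m → Fin m → ℝ) (r : Fin m → ℝ)
      (α β : Fin m), (N * Matrix.of fun σ β => ∑ τ, T σ β τ * r τ) α β =
        ∑ τ, r τ * ∑ σ, N α σ * T σ β τ := by
    intro N T r α β
    simp only [Matrix.mul_apply, Matrix.of_apply, Finset.mul_sum]
    rw [Finset.sum_comm]
    exact Finset.sum_congr rfl fun _ _ => Finset.sum_congr rfl fun _ _ => by ring
  have hs : ∀ r : Fin m → ℝ, toMat M * sMat c z r + (toMat M * sMat c z r).transpose = 0 := by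
    intro r
    ext α β
    rw [Matrix.add_apply, Matrix.transpose_apply, sMat, hsum, hsum, ← Finset.sum_add_distrib]
    refine Finset.sum_eq_zero fun τ _ => ?_
    have := h2 α β τ
    simp only [algS, S_rhs hc hO hz0] at this
    rw [← mul_add]
    exact mul_eq_zero_of_right _ this
  set t := sMat c z fun β => rhs c β (z, p, q) with ht
  set a' : Matrix (Fin m) (Fin m) ℝ := Matrix.of fun σ β =>
    ∑ τ, fderiv ℝ (c.C σ β τ) z (vecX p) * q τ + fderiv ℝ (c.A σ β) z (vecX p) with ha'
  set b' : Matrix (Fin m) (Fin m) ℝ := Matrix.of fun σ β =>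
    ∑ τ, fderiv ℝ (c.C σ τ β) z (vecY q) * p τ + fderiv ℝ (c.B σ β) z (vecY q) with hb'
  set s' : Matrix (Fin m) (Fin m) ℝ := Matrix.of fun σ β =>
    ∑ τ, dS c z (vecY q) σ β τ * p τ with hs'
  have hda : dOmMat c z (vecX p) (vecY q) = a' := by
    ext σ β
    simp [dOmMat, fderiv_Omega hc hO hz, ha', vecY]
  have hdb : dOmMat c z (vecY q) (vecX p) = b' + s' := by
    ext σ β
    simp [dOmMat, fderiv_Omega hc hO hz, hb', hs', vecX, dS, sub_mul, Finset.sum_sub_distrib]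
    ring
  have hHK : ∀ σ β, H (rhs c) σ β (z, p, q) 0 - K (rhs c) σ β (z, p, q) 0 =
      (bMat c z p * aMat c z q - aMat c z q * bMat c z p + a' - b' + t) σ β := by
    intro σ β
    have hz' : ((z, p, q) : Jet m).1 ∈ O := hz
    rw [H_rhs hc hO hz', K_rhs hc hO hz']
    simp [ha', hb', ht, sMat, sub_mul, Finset.sum_sub_distrib]
    ring
  have hmat := symmetrized_curvature_eq_zero (M := toMat M) (a := aMat c z q) (b := bMat c z p)
    (s := sMat c z p) (a' := a') (b' := b') (s' := s') (t := t) (toMat_transpose M) ?_ (hs _) (hs _)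
    ?_
  · have : toMat (curvature (connMap c) z (vecY q) (vecX p) M) = 0 := by
      rw [toMat_curvature hc hO hz, hda, hdb, omMat_vecY, omMat_vecX]
      exact hmat
    ext e
    induction e with | _ α β
    exact congrFun (congrFun this α) β
  · ext α β
    -- The condition and its copy with `α`, `β` exchanged add up to an equation in `H - K` alone.
    have e1 := h1 p q α β
    have e2 := h1 p q β α
    simp only [algHK] at e1 e2
    simp only [Matrix.add_apply _ (Matrix.transpose _), Matrix.transpose_apply, Matrix.mul_apply,
      ← hHK, mul_sub, Finset.sum_sub_distrib, toMat_apply, Matrix.zero_apply]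
    linarith
  -- `M * a` plus its transpose is the connection term for `M` in the direction `Y`, so the
  -- differentiated `S` condition applies.
  · rw [← omMat_vecY, ← toMat_connMap]
    ext α β
    simp only [Matrix.add_apply, Matrix.transpose_apply, hs', sMat, hsum, Matrix.zero_apply,
      ← Finset.sum_add_distrib, ← mul_add]
    refine Finset.sum_eq_zero fun τ _ => mul_eq_zero_of_right _ ?_
    have := h3 (vecY q) α β τ
    simp only [algS, S_rhs hc hO hz0] at this
    simp only [toMat_apply, Finset.sum_add_distrib]
    linarith

/-- Bilinearity lets the components be separated by degree in `p` and `q`: the bilinear part gives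
the `(∂/∂u, ∂/∂u)` components, which no single pair `(Y, X)` isolates. -/
theorem curvature_eq_zero {z : Base m} (hz : z ∈ O) {M : Sym2 (Fin m) → ℝ}
    (h1 : ∀ p q α β, algHK (rhs c) M α β (z, p, q) 0 0 = 0)
    (h2 : ∀ α β γ, algS (rhs c) M α β γ (z, 0, 0) = 0)
    (h3 : ∀ v α β γ, ∑ σ, M s(α, σ) * dS c z v σ β γ + ∑ σ, M s(β, σ) * dS c z v σ α γ +
      algS (rhs c) (connMap c z v M) α β γ (z, 0, 0) = 0) (v w : Base m) :
    curvature (connMap c) z v w M = 0 := by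
  have hR := curvature_vecY_vecX hc hO hz h1 h2 h3
  set R := fun v w => curvature (connMap c) z v w M with hRdef
  have hadd : ∀ v v' w, R (v + v') w = R v w + R v' w := fun v v' w => by
    simp only [hRdef, curvature, map_add, _root_.add_apply]; abel
  have hsmul : ∀ (t : ℝ) v w, R (t • v) w = t • R v w := fun t v w => by
    simp only [hRdef, curvature, map_smul, _root_.smul_apply]; module
  have hanti : ∀ v w, R v w = -R w v := fun v w => by
    simp only [hRdef, curvature]; abel
  have hadd' : ∀ v w w', R v (w + w') = R v w + R v w' := fun v w w' => by
    rw [hanti, hadd, hanti w, hanti w']; abel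
  have hsmul' : ∀ (t : ℝ) v w, R v (t • w) = t • R v w := fun t v w => by
    rw [hanti, hsmul, hanti w]; module
  have hself : ∀ v, R v v = 0 := fun v => self_eq_neg.1 (hanti v v)
  have hX : ∀ p : Fin m → ℝ, vecX p = vecX 0 + (0, 0, p) := fun p => by simp [vecX]
  have hY : ∀ q : Fin m → ℝ, vecY q = vecY 0 + (0, 0, q) := fun q => by simp [vecY]
  have e1 : R (vecY 0) (vecX 0) = 0 := hR 0 0
  have e2 : ∀ p, R (vecY 0) (0, 0, p) = 0 := fun p => by
    have := hR p 0
    change R _ _ = 0 at this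
    rwa [hX p, hadd', e1, zero_add] at this
  have e3 : ∀ q, R (0, 0, q) (vecX 0) = 0 := fun q => by
    have := hR 0 q
    change R _ _ = 0 at this
    rwa [hY q, hadd, e1, zero_add] at this
  have e4 : ∀ q p, R (0, 0, q) (0, 0, p) = 0 := fun q p => by
    have := hR p q
    change R _ _ = 0 at this
    rwa [hY q, hX p, hadd, hadd', hadd', e1, e2, e3, zero_add, zero_add, zero_add] at this
  have hdec : ∀ v : Base m, v = v.1 • vecX 0 + (v.2.1 • vecY 0 + (0, 0, v.2.2)) := fun v => by
    refine Prod.ext ?_ (Prod.ext ?_ ?_) <;> simp [vecX, vecY]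
  change R v w = 0
  rw [hdec v, hdec w]
  simp only [hadd, hadd', hsmul, hsmul', hself, e1, e2, e3, e4, hanti (vecX 0) (vecY 0),
    hanti (vecX 0) (0, 0, _), hanti (0, 0, _) (vecY 0)]
  simp

end Curvature

/-! ### Smoothness of the entries of `Φ_k` -/

section Smoothness

variable {f : Fin m → Jet m → ℝ} {U : Set (Jet m)}

theorem contDiffOn_H (hU : IsOpen U) (hf : ∀ α, ContDiffOn ℝ ∞ (f α) U) (γ α : Fin m)
    (a : Fin m → ℝ) : ContDiffOn ℝ ∞ (fun j => H f γ α j a) U := by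
  have h0 := fun α => (hf α)
  have h1 := fun v α => contDiffOn_pd hU (hf α) v
  have h2 := fun v w α => contDiffOn_pd hU (h1 v α) w
  have hp : ∀ β, ContDiffOn ℝ ∞ (fun j : Jet m => j.2.1 β) U := fun β => by fun_prop
  exact (((((h1 _ _).add (ContDiffOn.sum fun σ _ => (h1 _ _).mul (h1 _ _))).sub (h2 _ _ _)).sub
    (ContDiffOn.sum fun σ _ => (h2 _ _ _).mul (hp σ))).sub
    (ContDiffOn.sum fun σ _ => (h2 _ _ _).mul (h0 σ))).sub
    (ContDiffOn.sum fun σ _ => (h2 _ _ _).mul contDiffOn_const)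

theorem contDiffOn_K (hU : IsOpen U) (hf : ∀ α, ContDiffOn ℝ ∞ (f α) U) (γ α : Fin m)
    (a : Fin m → ℝ) : ContDiffOn ℝ ∞ (fun j => K f γ α j a) U := by
  have h0 := fun α => (hf α)
  have h1 := fun v α => contDiffOn_pd hU (hf α) v
  have h2 := fun v w α => contDiffOn_pd hU (h1 v α) w
  have hq : ∀ β, ContDiffOn ℝ ∞ (fun j : Jet m => j.2.2 β) U := fun β => by fun_prop
  exact (((((h1 _ _).add (ContDiffOn.sum fun σ _ => (h1 _ _).mul (h1 _ _))).sub (h2 _ _ _)).sub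
    (ContDiffOn.sum fun σ _ => (h2 _ _ _).mul (hq σ))).sub
    (ContDiffOn.sum fun σ _ => (h2 _ _ _).mul (h0 σ))).sub
    (ContDiffOn.sum fun σ _ => (h2 _ _ _).mul contDiffOn_const)

theorem contDiffOn_S (hU : IsOpen U) (hf : ∀ α, ContDiffOn ℝ ∞ (f α) U) (γ α β : Fin m) :
    ContDiffOn ℝ ∞ (S f γ α β) U :=
  (contDiffOn_pd hU (contDiffOn_pd hU (hf γ) _) _).sub
    (contDiffOn_pd hU (contDiffOn_pd hU (hf γ) _) _)

theorem contDiffOn_algHK (hU : IsOpen U) (hf : ∀ α, ContDiffOn ℝ ∞ (f α) U)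
    (M : Sym2 (Fin m) → ℝ) (α β : Fin m) (a b : Fin m → ℝ) :
    ContDiffOn ℝ ∞ (fun j => algHK f M α β j a b) U :=
  (ContDiffOn.sum fun _ _ => contDiffOn_const.mul (contDiffOn_H hU hf _ _ _)).sub
    (ContDiffOn.sum fun _ _ => contDiffOn_const.mul (contDiffOn_K hU hf _ _ _))

theorem contDiffOn_algRowValue (hU : IsOpen U) (hf : ∀ α, ContDiffOn ℝ ∞ (f α) U)
    (M : Sym2 (Fin m) → ℝ) (a : AlgRow m) : ContDiffOn ℝ ∞ (algRowValue f M a) U := by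
  have h := fun α β => contDiffOn_algHK hU hf M α β 0 0
  cases a with
  | hk α β => exact h α β
  | hkP α β σ => exact contDiffOn_pd hU (h α β) _
  | hkQ α β τ => exact contDiffOn_pd hU (h α β) _
  | hkPQ α β σ τ => exact contDiffOn_pd hU (contDiffOn_pd hU (h α β) _) _
  | s α β γ =>
    exact (ContDiffOn.sum fun _ _ => contDiffOn_const.mul (contDiffOn_S hU hf _ _ _)).add
      (ContDiffOn.sum fun _ _ => contDiffOn_const.mul (contDiffOn_S hU hf _ _ _))

theorem contDiffOn_rhs (hc : c.SmoothOn O) (α : Fin m) :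
    ContDiffOn ℝ ∞ (rhs c α) {j | j.1 ∈ O} := by
  have hb : ∀ {g : Base m → ℝ}, ContDiffOn ℝ ∞ g O →
      ContDiffOn ℝ ∞ (fun j : Jet m => g j.1) {j | j.1 ∈ O} := fun hg =>
    hg.comp contDiffOn_fst fun _ hj => hj
  have hp : ∀ β, ContDiffOn ℝ ∞ (fun j : Jet m => j.2.1 β) {j | j.1 ∈ O} := fun β => by fun_prop
  have hq : ∀ β, ContDiffOn ℝ ∞ (fun j : Jet m => j.2.2 β) {j | j.1 ∈ O} := fun β => by fun_prop
  exact (((ContDiffOn.sum fun β _ => ContDiffOn.sum fun γ _ => (hb (hc.C α β γ)).neg.mul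
    ((hp β).mul (hq γ))).add (ContDiffOn.sum fun γ _ => (hb (hc.A α γ)).neg.mul (hp γ))).add
    (ContDiffOn.sum fun γ _ => (hb (hc.B α γ)).neg.mul (hq γ))).add (hb (hc.E α)).neg

theorem contDiffOn_Phi (hc : c.SmoothOn O) (hO : IsOpen O) (k : ℕ) (a : RowIdx m k)
    (e : Sym2 (Fin m)) :
    ContDiffOn ℝ ∞ (fun j => Phi (rhs c) c k j a e) {j | j.1 ∈ O} := by
  have hU := isOpen_fst_preimage hO
  induction k generalizing e with
  | zero => exact contDiffOn_algRowValue hU (contDiffOn_rhs hc) _ a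
  | succ k ih =>
    rcases a with a | ⟨a, d⟩
    · exact ih a e
    · refine (contDiffOn_pd hU (ih a e) _).add (ContDiffOn.sum fun e' _ => (ih a e').mul ?_)
      have h1 : ContDiffOn ℝ ∞ (fun z => connMap c z d.vec (Pi.single e 1) e') O :=
        contDiffOn_pi.1 ((hc.contDiffOn_connMap.clm_apply contDiffOn_const).clm_apply
          contDiffOn_const) e'
      exact h1.comp contDiffOn_fst fun _ hj => hj

end Smoothness

/-! ### Linearity of the algebraic rows in `M` -/

section Linearity

theorem _root_.IsLinearMap.apply_eq_sum_single {ι : Type*} [Fintype ι] [DecidableEq ι]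
    {L : (ι → ℝ) → ℝ} (hL : IsLinearMap ℝ L) (M : ι → ℝ) :
    L M = ∑ e, M e * L (Pi.single e 1) := by
  change hL.mk' L M = ∑ e, M e * hL.mk' L (Pi.single e 1)
  conv_lhs => rw [← Finset.univ_sum_single M, map_sum]
  refine Finset.sum_congr rfl fun e _ => ?_
  rw [← smul_eq_mul, ← map_smul, ← Pi.single_smul, smul_eq_mul, mul_one]

theorem pd_sum {ι : Type*} [Fintype ι] {U : Set (Jet m)} (hU : IsOpen U) {g : ι → Jet m → ℝ}
    (hg : ∀ e, ContDiffOn ℝ ∞ (g e) U) (M : ι → ℝ) (v : Jet m) :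
    Set.EqOn (pd v fun j => ∑ e, M e * g e j) (fun j => ∑ e, M e * pd v (g e) j) U := by
  intro j hj
  have h := HasFDerivAt.fun_sum (u := Finset.univ) fun e _ =>
    ((((hg e).contDiffAt (hU.mem_nhds hj)).differentiableAt (by simp)).hasFDerivAt).const_mul (M e)
  simp [pd, h.fderiv]

variable {f : Fin m → Jet m → ℝ} {U : Set (Jet m)}

/-- `Φ_0` is defined through the values on basis vectors; linearity is what makes `Φ_0 *ᵥ M` the
value on `M`. For the differentiated rows it rests on differentiability of the entries. -/
theorem algRowValue_eq_sum (hU : IsOpen U) (hf : ∀ α, ContDiffOn ℝ ∞ (f α) U)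
    (M : Sym2 (Fin m) → ℝ) (a : AlgRow m) {j : Jet m} (hj : j ∈ U) :
    algRowValue f M a j = ∑ e, M e * algRowValue f (Pi.single e 1) a j := by
  have hlin : ∀ α β, (fun j => algHK f M α β j 0 0) =
      fun j => ∑ e, M e * algHK f (Pi.single e 1) α β j 0 0 := fun α β => by
    funext j
    exact IsLinearMap.apply_eq_sum_single (L := fun M => algHK f M α β j 0 0)
      ⟨fun M N => algHK_add f M N α β j 0 0, fun t M => algHK_smul f t M α β j 0 0⟩ M
  have hs := fun α β (e : Sym2 (Fin m)) => contDiffOn_algHK hU hf (Pi.single e 1) α β 0 0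
  cases a with
  | hk α β => exact congrFun (hlin α β) j
  | hkP α β σ =>
    simp only [algRowValue, hlin α β]
    exact pd_sum hU (hs α β) M _ hj
  | hkQ α β τ =>
    simp only [algRowValue, hlin α β]
    exact pd_sum hU (hs α β) M _ hj
  | hkPQ α β σ τ =>
    simp only [algRowValue]
    rw [hlin α β, pd_eqOn hU (pd_sum hU (hs α β) M (eQ τ)) _ hj]
    exact pd_sum hU (fun e => contDiffOn_pd hU (hs α β e) _) M _ hj
  | s α β γ =>
    exact IsLinearMap.apply_eq_sum_single (L := fun M => algS f M α β γ j)
      ⟨fun M N => algS_add f M N α β γ j, fun t M => algS_smul f t M α β γ j⟩ M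

end Linearity

/-! ### Dependence of the algebraic conditions on `u_x` and `u_y` -/

section Biaffine

/-- Functions of `(p, q)` that are affine in `p`. -/
def IsAffL (h : (Fin m → ℝ) → (Fin m → ℝ) → ℝ) : Prop :=
  ∃ (A : Fin m → ℝ) (E : ℝ), ∀ p q, h p q = ∑ γ, A γ * p γ + E

/-- Functions of `(p, q)` that are affine in `q`. -/
def IsAffR (h : (Fin m → ℝ) → (Fin m → ℝ) → ℝ) : Prop :=
  ∃ (A : Fin m → ℝ) (E : ℝ), ∀ p q, h p q = ∑ γ, A γ * q γ + E

/-- Functions of `(p, q)` that are affine in `p` and in `q`. -/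
def IsBiaff (h : (Fin m → ℝ) → (Fin m → ℝ) → ℝ) : Prop :=
  ∃ (C : Fin m → Fin m → ℝ) (A B : Fin m → ℝ) (E : ℝ), ∀ p q, h p q =
    ∑ β, ∑ γ, C β γ * (p β * q γ) + ∑ γ, A γ * p γ + ∑ γ, B γ * q γ + E

variable {h h' : (Fin m → ℝ) → (Fin m → ℝ) → ℝ}

theorem IsAffL.isBiaff (hh : IsAffL h) : IsBiaff h := by
  obtain ⟨A, E, hh⟩ := hh
  exact ⟨0, A, 0, E, fun p q => by simp [hh]⟩

theorem IsAffL.mul (hh : IsAffL h) (hh' : IsAffR h') : IsBiaff fun p q => h p q * h' p q := by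
  obtain ⟨A, E, hh⟩ := hh
  obtain ⟨A', E', hh'⟩ := hh'
  refine ⟨fun β γ => A β * A' γ, fun β => A β * E', fun γ => E * A' γ, E * E', fun p q => ?_⟩
  have e1 : ∑ β, ∑ γ, A β * A' γ * (p β * q γ) = (∑ β, A β * p β) * ∑ γ, A' γ * q γ := by
    rw [Finset.sum_mul_sum]
    exact Finset.sum_congr rfl fun _ _ => Finset.sum_congr rfl fun _ _ => by ring
  have e2 : ∑ β, A β * E' * p β = (∑ β, A β * p β) * E' := by
    rw [Finset.sum_mul]
    exact Finset.sum_congr rfl fun _ _ => by ring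
  have e3 : ∑ γ, E * A' γ * q γ = E * ∑ γ, A' γ * q γ := by
    rw [Finset.mul_sum]
    exact Finset.sum_congr rfl fun _ _ => by ring
  simp only [hh, hh', e1, e2, e3]
  ring

theorem IsBiaff.add (hh : IsBiaff h) (hh' : IsBiaff h') : IsBiaff fun p q => h p q + h' p q := by
  obtain ⟨C, A, B, E, hh⟩ := hh
  obtain ⟨C', A', B', E', hh'⟩ := hh'
  refine ⟨C + C', A + A', B + B', E + E', fun p q => ?_⟩
  simp only [hh, hh', Pi.add_apply, add_mul, Finset.sum_add_distrib]
  ring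

theorem IsBiaff.const_mul (t : ℝ) (hh : IsBiaff h) : IsBiaff fun p q => t * h p q := by
  obtain ⟨C, A, B, E, hh⟩ := hh
  refine ⟨fun β γ => t * C β γ, fun β => t * A β, fun β => t * B β, t * E, fun p q => ?_⟩
  simp only [hh, mul_add, Finset.mul_sum, mul_assoc]

theorem IsBiaff.sub (hh : IsBiaff h) (hh' : IsBiaff h') : IsBiaff fun p q => h p q - h' p q := by
  have := hh.add (hh'.const_mul (-1))
  simpa [sub_eq_add_neg] using this

theorem isBiaff_zero : IsBiaff fun _ _ : Fin m → ℝ => 0 := ⟨0, 0, 0, 0, fun p q => by simp⟩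

theorem isBiaff_sum {ι : Type*} (s : Finset ι) {g : ι → (Fin m → ℝ) → (Fin m → ℝ) → ℝ}
    (hg : ∀ i, IsBiaff (g i)) : IsBiaff fun p q => ∑ i ∈ s, g i p q := by
  classical
  induction s using Finset.induction_on with
  | empty => simpa using isBiaff_zero
  | insert i s hi ih => simpa [Finset.sum_insert hi] using (hg i).add ih

theorem isBiaff_biaff (C : Fin m → Fin m → Base m → ℝ) (A B : Fin m → Base m → ℝ)
    (E : Base m → ℝ) (z : Base m) : IsBiaff fun p q => biaff C A B E (z, p, q) :=
  ⟨fun β γ => C β γ z, fun γ => A γ z, fun γ => B γ z, E z, fun _ _ => rfl⟩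

theorem isAffL_bMat (z : Base m) (σ β : Fin m) : IsAffL fun p _ => bMat c z p σ β :=
  ⟨fun τ => c.C σ τ β z, c.B σ β z, fun _ _ => rfl⟩

theorem isAffR_aMat (z : Base m) (σ β : Fin m) : IsAffR fun _ q => aMat c z q σ β :=
  ⟨fun τ => c.C σ β τ z, c.A σ β z, fun _ _ => rfl⟩

theorem isAffL_vecX (L : Base m →L[ℝ] ℝ) : IsAffL fun p _ => L (vecX p) :=
  ⟨fun β => L (0, 0, Pi.single β 1), L (1, 0, 0), fun p _ => (apply_vecX L p).trans (add_comm _ _)⟩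

theorem isAffR_vecY (L : Base m →L[ℝ] ℝ) : IsAffR fun _ q => L (vecY q) :=
  ⟨fun β => L (0, 0, Pi.single β 1), L (0, 1, 0), fun _ q => (apply_vecY L q).trans (add_comm _ _)⟩

theorem isAffL_coord (β : Fin m) : IsAffL fun p _ => p β :=
  ⟨Pi.single β 1, 0, fun p _ => by simp [Pi.single_apply]⟩

theorem isAffR_coord (β : Fin m) : IsAffR fun _ q => q β :=
  ⟨Pi.single β 1, 0, fun _ q => by simp [Pi.single_apply]⟩

theorem IsAffR.isBiaff (hh : IsAffR h) : IsBiaff h := by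
  obtain ⟨A, E, hh⟩ := hh
  exact ⟨0, 0, A, E, fun p q => by simp [hh]⟩

variable (hc : c.SmoothOn O) (hO : IsOpen O)
include hc hO

theorem isBiaff_pd_eU {z : Base m} (hz : z ∈ O) (γ α : Fin m) :
    IsBiaff fun p q => pd (eU α) (rhs c γ) (z, p, q) := by
  refine ⟨fun β τ => -fderiv ℝ (c.C γ β τ) z (eU α : Jet m).1,
    fun τ => -fderiv ℝ (c.A γ τ) z (eU α : Jet m).1,
    fun τ => -fderiv ℝ (c.B γ τ) z (eU α : Jet m).1,
    -fderiv ℝ (c.E γ) z (eU α : Jet m).1, fun p q => ?_⟩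
  refine (pd_eU_rhs hc hO (j := (z, p, q)) hz γ α).trans ?_
  simp only [neg_mul, Finset.sum_neg_distrib]
  ring

/-- Every product in the formulas for `H` and `K` has one factor affine in `u_x` and one affine in
`u_y`; the other terms are biaffine by themselves. -/
theorem isBiaff_algHK {z : Base m} (hz : z ∈ O) (M : Sym2 (Fin m) → ℝ) (α β : Fin m) :
    IsBiaff fun p q => algHK (rhs c) M α β (z, p, q) 0 0 := by
  have hH : ∀ γ α, IsBiaff fun p q => H (rhs c) γ α (z, p, q) 0 := by
    intro γ α
    have e : ∀ p q, H (rhs c) γ α (z, p, q) 0 = _ := fun p q => H_rhs hc hO hz γ α 0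
    simp only [e, Matrix.mul_apply]
    exact (((isBiaff_pd_eU hc hO hz γ α).add (isBiaff_sum _ fun σ =>
      (isAffL_bMat z γ σ).mul (isAffR_aMat z σ α))).add ((isBiaff_sum _ fun τ =>
      (isAffL_vecX _).mul (isAffR_coord τ)).add (isAffL_vecX _).isBiaff)).add
      (isBiaff_sum _ fun σ => (isBiaff_biaff _ _ _ _ z).const_mul _)
  have hK : ∀ γ α, IsBiaff fun p q => K (rhs c) γ α (z, p, q) 0 := by
    intro γ α
    have e : ∀ p q, K (rhs c) γ α (z, p, q) 0 = _ := fun p q => K_rhs hc hO hz γ α 0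
    simp only [e, Matrix.mul_apply, mul_comm (aMat _ _ _ _ _), mul_comm (fderiv _ _ _ _) (_ : ℝ)]
    exact (((isBiaff_pd_eU hc hO hz γ α).add (isBiaff_sum _ fun σ =>
      (isAffL_bMat z σ α).mul (isAffR_aMat z γ σ))).add ((isBiaff_sum _ fun τ =>
      (isAffL_coord τ).mul (isAffR_vecY _)).add (isAffR_vecY _).isBiaff)).add
      (isBiaff_sum _ fun σ => (isBiaff_biaff _ _ _ _ z).const_mul _)
  exact (isBiaff_sum _ fun σ => (hH σ β).const_mul _).sub
    (isBiaff_sum _ fun σ => (hK σ α).const_mul _)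

/-- A smooth function which is affine in `u_x` and in `u_y` on the fibre over `z` vanishes there
if it and its derivatives with respect to `u_x` and `u_y` vanish at one point. -/
theorem algHK_eq_zero {z : Base m} (hz : z ∈ O) {M : Sym2 (Fin m) → ℝ}
    {pq : (Fin m → ℝ) × (Fin m → ℝ)} (hM : ∀ a, algRowValue (rhs c) M a (z, pq) = 0)
    (α β : Fin m) (p q : Fin m → ℝ) : algHK (rhs c) M α β (z, p, q) 0 0 = 0 := by
  have hU := isOpen_fst_preimage hO
  obtain ⟨C, A, B, E, hh⟩ := isBiaff_algHK hc hO hz M α β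
  obtain ⟨p₀, q₀⟩ := pq
  set g : Jet m → ℝ := fun j => algHK (rhs c) M α β j 0 0 with hg
  have hgs : ContDiffOn ℝ ∞ g {j | j.1 ∈ O} := contDiffOn_algHK hU (contDiffOn_rhs hc) M α β 0 0
  have hdiff : ∀ {g : Jet m → ℝ}, ContDiffOn ℝ ∞ g {j | j.1 ∈ O} → ∀ p q,
      DifferentiableAt ℝ g (z, p, q) := fun hg p q =>
    (hg.contDiffAt (hU.mem_nhds hz)).differentiableAt (by simp)
  have hp : ∀ (p v : Fin m → ℝ) β, HasDerivAt (fun t : ℝ => p β + t * v β) (v β) 0 :=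
    fun p v β => by simpa using ((hasDerivAt_id (0 : ℝ)).mul_const (v β)).const_add (p β)
  have hP : ∀ σ p q, pd (eP σ) g (z, p, q) = ∑ γ, C σ γ * q γ + A σ := by
    intro σ p q
    refine pd_eq_of_hasDerivAt (hdiff hgs p q) ?_
    have h1 := (HasDerivAt.fun_sum (u := Finset.univ) fun β _ => HasDerivAt.fun_sum
      (u := Finset.univ) fun γ _ => ((hp p (Pi.single σ 1) β).mul_const (q γ)).const_mul (C β γ))
    have h2 := HasDerivAt.fun_sum (u := Finset.univ) fun γ _ =>
      (hp p (Pi.single σ 1) γ).const_mul (A γ)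
    have h3 := ((h1.fun_add h2).add_const (∑ γ, B γ * q γ)).add_const E
    have e : (fun t : ℝ => g ((z, p, q) + t • eP σ)) = fun t : ℝ =>
        ∑ β, ∑ γ, C β γ * ((p β + t * Pi.single (M := fun _ => ℝ) σ 1 β) * q γ)
          + ∑ γ, A γ * (p γ + t * Pi.single (M := fun _ => ℝ) σ 1 γ) + ∑ γ, B γ * q γ + E := by
      funext t
      have : ((z, p, q) : Jet m) + t • eP σ = (z, p + t • Pi.single σ 1, q) := by
        simp [eP, Prod.mk_zero_zero]
      rw [this]
      exact hh _ _
    rw [e]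
    refine h3.congr_deriv ?_
    simp [Pi.single_apply]
  have hQ : ∀ σ p q, pd (eQ σ) g (z, p, q) = ∑ γ, C γ σ * p γ + B σ := by
    intro σ p q
    refine pd_eq_of_hasDerivAt (hdiff hgs p q) ?_
    have h1 := (HasDerivAt.fun_sum (u := Finset.univ) fun β _ => HasDerivAt.fun_sum
      (u := Finset.univ) fun γ _ => ((hp q (Pi.single σ 1) γ).const_mul (p β)).const_mul (C β γ))
    have h2 := HasDerivAt.fun_sum (u := Finset.univ) fun γ _ =>
      (hp q (Pi.single σ 1) γ).const_mul (B γ)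
    have h3 := ((h1.add_const (∑ γ, A γ * p γ)).fun_add h2).add_const E
    have e : (fun t : ℝ => g ((z, p, q) + t • eQ σ)) = fun t : ℝ =>
        ∑ β, ∑ γ, C β γ * (p β * (q γ + t * Pi.single (M := fun _ => ℝ) σ 1 γ))
          + ∑ γ, A γ * p γ + ∑ γ, B γ * (q γ + t * Pi.single (M := fun _ => ℝ) σ 1 γ) + E := by
      funext t
      have : ((z, p, q) : Jet m) + t • eQ σ = (z, p, q + t • Pi.single σ 1) := by
        simp [eQ, Prod.mk_zero_zero]
      rw [this]
      exact hh _ _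
    rw [e]
    refine h3.congr_deriv ?_
    simp [Pi.single_apply]
  have hPQ : ∀ σ τ, pd (eP σ) (pd (eQ τ) g) (z, p₀, q₀) = C σ τ := by
    intro σ τ
    refine pd_eq_of_hasDerivAt (hdiff (contDiffOn_pd hU hgs _) p₀ q₀) ?_
    have h2 := (HasDerivAt.fun_sum (u := Finset.univ) fun γ _ =>
      (hp p₀ (Pi.single σ 1) γ).const_mul (C γ τ)).add_const (B τ)
    have e : (fun t : ℝ => pd (eQ τ) g ((z, p₀, q₀) + t • eP σ)) = fun t : ℝ =>
        ∑ γ, C γ τ * (p₀ γ + t * Pi.single (M := fun _ => ℝ) σ 1 γ) + B τ := by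
      funext t
      have : ((z, p₀, q₀) : Jet m) + t • eP σ = (z, p₀ + t • Pi.single σ 1, q₀) := by
        simp [eP, Prod.mk_zero_zero]
      rw [this]
      exact hQ _ _ _
    rw [e]
    refine h2.congr_deriv ?_
    simp [Pi.single_apply]
  -- The system is triangular: the mixed derivative gives the bilinear coefficients, then the first
  -- derivatives the linear ones, then the value the constant.
  have hC0 : ∀ σ τ, C σ τ = 0 := fun σ τ => (hPQ σ τ).symm.trans (hM (.hkPQ α β σ τ))
  have hA0 : ∀ σ, A σ = 0 := fun σ => by
    have := (hP σ p₀ q₀).symm.trans (hM (.hkP α β σ))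
    simpa [hC0] using this
  have hB0 : ∀ σ, B σ = 0 := fun σ => by
    have := (hQ σ p₀ q₀).symm.trans (hM (.hkQ α β σ))
    simpa [hC0] using this
  have hE0 : E = 0 := by
    have := (hh p₀ q₀).symm.trans (hM (.hk α β))
    simpa [hC0, hA0, hB0] using this
  refine (hh p q).trans ?_
  simp [hC0, hA0, hB0, hE0]

theorem algHK_eq_zero' {z : Base m} (hz : z ∈ O) {M : Sym2 (Fin m) → ℝ}
    {pq : (Fin m → ℝ) × (Fin m → ℝ)} (hM : ∀ a, algRowValue (rhs c) M a (z, pq) = 0)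
    (α β : Fin m) (p q a b : Fin m → ℝ) : algHK (rhs c) M α β (z, p, q) a b = 0 := by
  have h := algHK_eq_zero hc hO hz hM α β p q
  have hz' : ((z, p, q) : Jet m).1 ∈ O := hz
  simpa only [algHK, H_rhs hc hO hz', K_rhs hc hO hz'] using h

end Biaffine

/-! ### The kernels of `Φ_k` over a fixed fibre coordinate -/

section Rows

instance : Finite (AlgRow m) := by
  let g : ((Fin m × Fin m) ⊕ (Fin m × Fin m × Fin m) ⊕ (Fin m × Fin m × Fin m) ⊕
      (Fin m × Fin m × Fin m × Fin m) ⊕ (Fin m × Fin m × Fin m)) → AlgRow m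
    | .inl (α, β) => .hk α β
    | .inr (.inl (α, β, σ)) => .hkP α β σ
    | .inr (.inr (.inl (α, β, τ))) => .hkQ α β τ
    | .inr (.inr (.inr (.inl (α, β, σ, τ)))) => .hkPQ α β σ τ
    | .inr (.inr (.inr (.inr (α, β, γ)))) => .s α β γ
  refine Finite.of_surjective g fun a => ?_
  cases a with
  | hk α β => exact ⟨.inl (α, β), rfl⟩
  | hkP α β σ => exact ⟨.inr (.inl (α, β, σ)), rfl⟩
  | hkQ α β τ => exact ⟨.inr (.inr (.inl (α, β, τ))), rfl⟩
  | hkPQ α β σ τ => exact ⟨.inr (.inr (.inr (.inl (α, β, σ, τ)))), rfl⟩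
  | s α β γ => exact ⟨.inr (.inr (.inr (.inr (α, β, γ)))), rfl⟩

instance : Finite (Dir m) := by
  let g : Option (Option (Fin m)) → Dir m
    | none => .x
    | some none => .y
    | some (some τ) => .u τ
  refine Finite.of_surjective g fun a => ?_
  cases a with
  | x => exact ⟨none, rfl⟩
  | y => exact ⟨some none, rfl⟩
  | u τ => exact ⟨some (some τ), rfl⟩

instance finite_rowIdx (k : ℕ) : Finite (RowIdx m k) := by
  induction k with
  | zero => exact inferInstanceAs (Finite (AlgRow m))
  | succ k ih => exact inferInstanceAs (Finite (RowIdx m k ⊕ (RowIdx m k × Dir m)))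

instance (k : ℕ) : Fintype (RowIdx m k) := Fintype.ofFinite _

/-- The matrix `Φ_k` of the system in normal form at `(z, pq)`, as a linear map. -/
def rowMap (c : Coeffs m) (k : ℕ) (pq : (Fin m → ℝ) × (Fin m → ℝ)) (z : Base m) :
    (Sym2 (Fin m) → ℝ) →L[ℝ] (RowIdx m k → ℝ) :=
  LinearMap.toContinuousLinearMap (Phi (rhs c) c k (z, pq)).mulVecLin

variable {pq : (Fin m → ℝ) × (Fin m → ℝ)}

theorem rowMap_apply (k : ℕ) (z : Base m) (M : Sym2 (Fin m) → ℝ) (a : RowIdx m k) :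
    rowMap c k pq z M a = ∑ e, Phi (rhs c) c k (z, pq) a e * M e := rfl

theorem finrank_range_rowMap (k : ℕ) (z : Base m) :
    Module.finrank ℝ (LinearMap.range (rowMap c k pq z).toLinearMap) =
      (Phi (rhs c) c k (z, pq)).rank := rfl

theorem rowMap_succ_inl (k : ℕ) (z : Base m) (M : Sym2 (Fin m) → ℝ) (a : RowIdx m k) :
    rowMap c (k + 1) pq z M (Sum.inl a) = rowMap c k pq z M a := rfl

theorem rank_Phi_le_succ (f : Fin m → Jet m → ℝ) (c : Coeffs m) (k : ℕ) (j : Jet m) :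
    (Phi f c k j).rank ≤ (Phi f c (k + 1) j).rank := by
  let L : (RowIdx m (k + 1) → ℝ) →ₗ[ℝ] (RowIdx m k → ℝ) := LinearMap.funLeft ℝ ℝ Sum.inl
  have h : (Phi f c k j).mulVecLin = L.comp (Phi f c (k + 1) j).mulVecLin := rfl
  unfold Matrix.rank
  rw [h, LinearMap.range_comp]
  exact Submodule.finrank_map_le _ _

theorem card_sym2_fin (m : ℕ) : Fintype.card (Sym2 (Fin m)) = m * (m + 1) / 2 := by
  rw [Sym2.card, Fintype.card_fin, Nat.choose_two_right, Nat.add_sub_cancel, mul_comm]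

theorem rank_Phi_le (f : Fin m → Jet m → ℝ) (c : Coeffs m) (k : ℕ) (j : Jet m) :
    (Phi f c k j).rank ≤ m * (m + 1) / 2 :=
  (Matrix.rank_le_card_width _).trans (card_sym2_fin m).le

theorem finrank_ker_rowMap (k : ℕ) (z : Base m) :
    Module.finrank ℝ (LinearMap.ker (rowMap c k pq z).toLinearMap) +
      (Phi (rhs c) c k (z, pq)).rank = m * (m + 1) / 2 := by
  have := LinearMap.finrank_range_add_finrank_ker (rowMap c k pq z).toLinearMap
  rw [finrank_range_rowMap, Module.finrank_fintype_fun_eq_card, card_sym2_fin] at this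
  omega

theorem rowMap_eq_zero_of_succ {k : ℕ} {z : Base m} {M : Sym2 (Fin m) → ℝ}
    (h : rowMap c (k + 1) pq z M = 0) : rowMap c k pq z M = 0 :=
  funext fun a => congrFun h (Sum.inl a)

theorem rowMap_zero_of_rowMap {k : ℕ} {z : Base m} {M : Sym2 (Fin m) → ℝ}
    (h : rowMap c k pq z M = 0) : rowMap c 0 pq z M = 0 := by
  induction k with
  | zero => exact h
  | succ k ih => exact ih (rowMap_eq_zero_of_succ h)

/-- The kernels are nested, and equal rank makes their dimensions equal. -/
theorem rowMap_succ_eq_zero_of_rank_eq {k : ℕ} {z : Base m} {M : Sym2 (Fin m) → ℝ}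
    (hr : (Phi (rhs c) c (k + 1) (z, pq)).rank = (Phi (rhs c) c k (z, pq)).rank)
    (h : rowMap c k pq z M = 0) : rowMap c (k + 1) pq z M = 0 := by
  have hle : LinearMap.ker (rowMap c (k + 1) pq z).toLinearMap ≤
      LinearMap.ker (rowMap c k pq z).toLinearMap := fun N hN => rowMap_eq_zero_of_succ hN
  have heq := Submodule.eq_of_le_of_finrank_eq hle (by
    have h1 := finrank_ker_rowMap (c := c) (pq := pq) k z
    have h2 := finrank_ker_rowMap (c := c) (pq := pq) (k + 1) z
    omega)
  have : M ∈ LinearMap.ker (rowMap c k pq z).toLinearMap := h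
  rw [← heq] at this
  exact this

theorem rank_succ_eq_of_rowMap {k : ℕ} {z : Base m}
    (h : ∀ M, rowMap c k pq z M = 0 → rowMap c (k + 1) pq z M = 0) :
    (Phi (rhs c) c (k + 1) (z, pq)).rank = (Phi (rhs c) c k (z, pq)).rank := by
  have heq : LinearMap.ker (rowMap c (k + 1) pq z).toLinearMap =
      LinearMap.ker (rowMap c k pq z).toLinearMap :=
    le_antisymm (fun N hN => rowMap_eq_zero_of_succ hN) fun N hN => h N hN
  have h1 := finrank_ker_rowMap (c := c) (pq := pq) k z
  have h2 := finrank_ker_rowMap (c := c) (pq := pq) (k + 1) z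
  rw [heq] at h2
  omega

theorem covDeriv_eq_sum (k : ℕ) (z v : Base m) (M : Sym2 (Fin m) → ℝ) :
    covDeriv (connMap c) (rowMap c k pq) z v M =
      v.1 • covDeriv (connMap c) (rowMap c k pq) z (Dir.x : Dir m).vec M
      + v.2.1 • covDeriv (connMap c) (rowMap c k pq) z (Dir.y : Dir m).vec M
      + ∑ τ, v.2.2 τ • covDeriv (connMap c) (rowMap c k pq) z (Dir.u τ).vec M := by
  let L : Base m →ₗ[ℝ] (RowIdx m k → ℝ) :=
    { toFun := fun v => covDeriv (connMap c) (rowMap c k pq) z v M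
      map_add' := fun v w => by simp only [covDeriv, map_add, _root_.add_apply]; abel
      map_smul' := fun t v => by
        simp only [covDeriv, map_smul, _root_.smul_apply, RingHom.id_apply, smul_add] }
  have hv : v = v.1 • (Dir.x : Dir m).vec + v.2.1 • (Dir.y : Dir m).vec
      + ∑ τ, v.2.2 τ • (Dir.u τ).vec := by
    refine Prod.ext ?_ (Prod.ext ?_ ?_)
    · simp [Dir.vec, Prod.fst_sum]
    · simp [Dir.vec, Prod.fst_sum, Prod.snd_sum]
    · ext i
      simp [Dir.vec, Prod.snd_sum, Finset.sum_apply, Pi.single_apply]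
  have : L v = v.1 • L (Dir.x : Dir m).vec + v.2.1 • L (Dir.y : Dir m).vec
      + ∑ τ, v.2.2 τ • L (Dir.u τ).vec := by
    conv_lhs => rw [hv]
    simp only [map_add, map_sum, map_smul]
  exact this

variable (hc : c.SmoothOn O) (hO : IsOpen O)
include hc hO

theorem contDiffOn_rowMap (k : ℕ) : ContDiffOn ℝ ∞ (rowMap c k pq) O := by
  refine contDiffOn_clm_apply.2 fun M => contDiffOn_pi.2 fun a => ?_
  simp only [rowMap_apply]
  exact ContDiffOn.sum fun e _ => ((contDiffOn_Phi hc hO k a e).comp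
    (contDiffOn_id.prodMk contDiffOn_const) fun z hz => hz).mul contDiffOn_const

theorem differentiableAt_rowMap (k : ℕ) {z : Base m} (hz : z ∈ O) :
    DifferentiableAt ℝ (rowMap c k pq) z :=
  ((contDiffOn_rowMap hc hO k).contDiffAt (hO.mem_nhds hz)).differentiableAt (by simp)

theorem hasFDerivAt_rowMap_apply (k : ℕ) {z : Base m} (hz : z ∈ O)
    (M : Sym2 (Fin m) → ℝ) (a : RowIdx m k) :
    HasFDerivAt (fun z' => rowMap c k pq z' M a)
      ((ContinuousLinearMap.proj a).comp ((fderiv ℝ (rowMap c k pq) z).flip M)) z := by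
  have h1 := hasFDerivAt_pi'.1
    ((differentiableAt_rowMap (pq := pq) hc hO k hz).hasFDerivAt.clm_apply
      (hasFDerivAt_const M z)) a
  simpa using h1

/-- Links the matrices to the abstract theory of connections. The prolongation never differentiates
along the fibre, so `pq` may stay frozen. -/
theorem rowMap_succ_inr (k : ℕ) {z : Base m} (hz : z ∈ O) (M : Sym2 (Fin m) → ℝ)
    (a : RowIdx m k) (d : Dir m) : rowMap c (k + 1) pq z M (Sum.inr (a, d)) =
      covDeriv (connMap c) (rowMap c k pq) z d.vec M a := by
  have h1 := hasFDerivAt_rowMap_apply (pq := pq) hc hO k hz M a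
  have hΦ : ∀ e, HasFDerivAt (fun z' => Phi (rhs c) c k (z', pq) a e)
      ((fderiv ℝ (fun j => Phi (rhs c) c k j a e) (z, pq)).comp
        ((ContinuousLinearMap.id ℝ (Base m)).prod 0)) z := fun e => by
    have hd : DifferentiableAt ℝ (fun j => Phi (rhs c) c k j a e) (z, pq) :=
      ((contDiffOn_Phi hc hO k a e).contDiffAt
        ((isOpen_fst_preimage hO).mem_nhds hz)).differentiableAt (by simp)
    exact HasFDerivAt.comp (f := fun z' => (z', pq)) z hd.hasFDerivAt
      ((hasFDerivAt_id z).prodMk (hasFDerivAt_const pq z))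
  have h2 := HasFDerivAt.fun_sum (u := Finset.univ) fun e _ => (hΦ e).mul_const (M e)
  have h3 := congrArg (fun L => L d.vec) (h1.unique h2)
  have h4 : fderiv ℝ (rowMap c k pq) z d.vec M a =
      ∑ e, pd (d.vec, 0, 0) (fun j' => Phi (rhs c) c k j' a e) (z, pq) * M e := by
    refine Eq.trans h3 ?_
    simp [pd, mul_comm]
    rfl
  have h5 : ∀ e', connAct c z d.vec M e' = ∑ e, M e * connAct c z d.vec (Pi.single e 1) e' :=
    fun e' => IsLinearMap.apply_eq_sum_single (L := fun M => connMap c z d.vec M e')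
      ⟨fun M N => by simp, fun t M => by simp⟩ M
  change ∑ e, (_ + _) * M e = fderiv ℝ (rowMap c k pq) z d.vec M a +
    ∑ e', Phi (rhs c) c k (z, pq) a e' * connAct c z d.vec M e'
  simp only [add_mul, Finset.sum_add_distrib, h4, h5, Finset.sum_mul, Finset.mul_sum]
  congr 1
  rw [Finset.sum_comm]
  exact Finset.sum_congr rfl fun _ _ => Finset.sum_congr rfl fun _ _ => by ring

theorem covDeriv_eq_zero_of_rowMap_succ {k : ℕ} {z : Base m} (hz : z ∈ O)
    {M : Sym2 (Fin m) → ℝ} (h : rowMap c (k + 1) pq z M = 0) (v : Base m) :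
    covDeriv (connMap c) (rowMap c k pq) z v M = 0 := by
  have hd : ∀ d : Dir m, covDeriv (connMap c) (rowMap c k pq) z d.vec M = 0 := fun d => by
    ext a
    rw [← rowMap_succ_inr hc hO k hz, h]
    rfl
  rw [covDeriv_eq_sum, hd, hd]
  simp [hd]

theorem rowMap_succ_eq_zero {k : ℕ} {z : Base m} (hz : z ∈ O) {M : Sym2 (Fin m) → ℝ}
    (h : rowMap c k pq z M = 0) (h' : ∀ v, covDeriv (connMap c) (rowMap c k pq) z v M = 0) :
    rowMap c (k + 1) pq z M = 0 := by
  ext a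
  rcases a with a | ⟨a, d⟩
  · rw [rowMap_succ_inl, h]
    rfl
  · rw [rowMap_succ_inr hc hO k hz, h']
    rfl

/-- The constant `2 + m` counts the coordinate directions. -/
theorem norm_covDeriv_le (k : ℕ) {z : Base m} (hz : z ∈ O) (v : Base m)
    (M : Sym2 (Fin m) → ℝ) : ‖covDeriv (connMap c) (rowMap c k pq) z v M‖ ≤
      (2 + m) * ‖v‖ * ‖rowMap c (k + 1) pq z M‖ := by
  have hd : ∀ d : Dir m, ‖covDeriv (connMap c) (rowMap c k pq) z d.vec M‖ ≤
      ‖rowMap c (k + 1) pq z M‖ := fun d => by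
    refine (pi_norm_le_iff_of_nonneg (norm_nonneg _)).2 fun a => ?_
    rw [← rowMap_succ_inr hc hO k hz]
    exact norm_le_pi_norm (rowMap c (k + 1) pq z M) (Sum.inr (a, d) : RowIdx m (k + 1))
  have hv1 : ‖v.1‖ ≤ ‖v‖ := norm_fst_le v
  have hv2 : ‖v.2.1‖ ≤ ‖v‖ := (norm_fst_le v.2).trans (norm_snd_le v)
  have hv3 : ∀ τ, ‖v.2.2 τ‖ ≤ ‖v‖ := fun τ =>
    (norm_le_pi_norm _ τ).trans ((norm_snd_le v.2).trans (norm_snd_le v))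
  rw [covDeriv_eq_sum]
  refine (norm_add₃_le).trans ?_
  have h3 : ‖∑ τ, v.2.2 τ • covDeriv (connMap c) (rowMap c k pq) z (Dir.u τ).vec M‖ ≤
      ∑ _τ : Fin m, ‖v‖ * ‖rowMap c (k + 1) pq z M‖ :=
    norm_sum_le_of_le _ fun τ _ => by
      rw [norm_smul]
      exact mul_le_mul (hv3 τ) (hd _) (norm_nonneg _) (norm_nonneg _)
  rw [Finset.sum_const, Finset.card_univ, Fintype.card_fin, nsmul_eq_mul] at h3
  have h1 : ‖v.1 • covDeriv (connMap c) (rowMap c k pq) z (Dir.x : Dir m).vec M‖ ≤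
      ‖v‖ * ‖rowMap c (k + 1) pq z M‖ := by
    rw [norm_smul]
    exact mul_le_mul hv1 (hd _) (norm_nonneg _) (norm_nonneg _)
  have h2 : ‖v.2.1 • covDeriv (connMap c) (rowMap c k pq) z (Dir.y : Dir m).vec M‖ ≤
      ‖v‖ * ‖rowMap c (k + 1) pq z M‖ := by
    rw [norm_smul]
    exact mul_le_mul hv2 (hd _) (norm_nonneg _) (norm_nonneg _)
  linarith

/-- Where `Φ_k` and `Φ_{k+1}` have the same constant rank, the rows of the latter are locally
uniformly dominated by those of the former. -/
theorem eventually_norm_rowMap_succ_le {k r : ℕ} {D : Set (Base m)} (hD : IsOpen D) (hDO : D ⊆ O)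
    (h0 : ∀ z ∈ D, (Phi (rhs c) c k (z, pq)).rank = r)
    (h1 : ∀ z ∈ D, (Phi (rhs c) c (k + 1) (z, pq)).rank = r) {z : Base m} (hz : z ∈ D) :
    ∃ K : ℝ, 0 ≤ K ∧ ∀ᶠ x in 𝓝 z, ∀ M,
      ‖rowMap c (k + 1) pq x M‖ ≤ K * ‖rowMap c k pq x M‖ := by
  refine eventually_norm_le_of_ker_le (differentiableAt_rowMap hc hO k (hDO hz)).continuousAt
    (differentiableAt_rowMap hc hO (k + 1) (hDO hz)).continuousAt ?_ ?_
  · filter_upwards [hD.mem_nhds hz] with x hx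
    rw [finrank_range_rowMap, finrank_range_rowMap, h0 x hx, h0 z hz]
  · filter_upwards [hD.mem_nhds hz] with x hx M hM
    exact rowMap_succ_eq_zero_of_rank_eq ((h1 x hx).trans (h0 x hx).symm) hM

/-- On `ker Φ_{k+1}` both `Φ_k` and its covariant derivatives vanish. Since `Φ_{k+1}` is dominated
by `Φ_k`, its own covariant derivatives vanish there too, and `Φ_{k+2}` imposes nothing new. -/
theorem rank_Phi_add_two {k r : ℕ} {D : Set (Base m)} (hD : IsOpen D) (hDO : D ⊆ O)
    (h0 : ∀ z ∈ D, (Phi (rhs c) c k (z, pq)).rank = r)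
    (h1 : ∀ z ∈ D, (Phi (rhs c) c (k + 1) (z, pq)).rank = r) :
    ∀ z ∈ D, (Phi (rhs c) c (k + 2) (z, pq)).rank = r := by
  intro z hz
  obtain ⟨K, -, hK⟩ := eventually_norm_rowMap_succ_le hc hO hD hDO h0 h1 hz
  rw [← h1 z hz]
  refine rank_succ_eq_of_rowMap fun M hM => rowMap_succ_eq_zero hc hO (hDO hz) hM fun v => ?_
  exact covDeriv_eq_zero_of_norm_le (differentiableAt_rowMap hc hO k (hDO hz))
    (differentiableAt_rowMap hc hO (k + 1) (hDO hz)) hK (rowMap_eq_zero_of_succ hM)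
    (covDeriv_eq_zero_of_rowMap_succ hc hO (hDO hz) hM v)

theorem eventually_rank_Phi_le (k : ℕ) {z : Base m} (hz : z ∈ O) :
    ∀ᶠ z' in 𝓝 z, (Phi (rhs c) c k (z, pq)).rank ≤ (Phi (rhs c) c k (z', pq)).rank := by
  filter_upwards [eventually_finrank_range_le
    (differentiableAt_rowMap (pq := pq) hc hO k hz).continuousAt] with z' hz'
  rwa [finrank_range_rowMap, finrank_range_rowMap] at hz'

theorem rowMap_zero_apply {z : Base m} (hz : z ∈ O) (M : Sym2 (Fin m) → ℝ) (a : AlgRow m) :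
    rowMap c 0 pq z M (a : RowIdx m 0) = algRowValue (rhs c) M a (z, pq) := by
  refine (rowMap_apply 0 z M a).trans ?_
  refine Eq.trans ?_ (algRowValue_eq_sum (isOpen_fst_preimage hO) (contDiffOn_rhs hc) M a
    (show (z, pq) ∈ {j : Jet m | j.1 ∈ O} from hz)).symm
  exact Finset.sum_congr rfl fun e _ => mul_comm _ _

theorem rowMap_zero_eq_zero_iff {z : Base m} (hz : z ∈ O) {M : Sym2 (Fin m) → ℝ} :
    rowMap c 0 pq z M = 0 ↔ ∀ a, algRowValue (rhs c) M a (z, pq) = 0 :=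
  ⟨fun h a => (rowMap_zero_apply hc hO hz M a).symm.trans (congrFun h (a : RowIdx m 0)),
    fun h => funext fun a => (rowMap_zero_apply hc hO hz M a).trans (h a)⟩

theorem rowMap_zero_s {z : Base m} (hz : z ∈ O) (M : Sym2 (Fin m) → ℝ) (α β γ : Fin m) :
    rowMap c 0 pq z M (AlgRow.s α β γ : RowIdx m 0) =
      ∑ σ, M s(α, σ) * (c.C σ β γ z - c.C σ γ β z) +
        ∑ σ, M s(β, σ) * (c.C σ α γ z - c.C σ γ α z) := by
  have hz' : ((z, pq) : Jet m).1 ∈ O := hz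
  refine (rowMap_zero_apply hc hO hz M (.s α β γ)).trans ?_
  simp only [algRowValue, algS, S_rhs hc hO hz']

/-- `Φ_0` supplies the `H`-`K` condition on the whole fibre and the `S` condition; one prolongation
is needed only for the covariant derivative of the latter. -/
theorem curvature_eq_zero_of_rowMap_one {z : Base m} (hz : z ∈ O) {M : Sym2 (Fin m) → ℝ}
    (h : rowMap c 1 pq z M = 0) (v w : Base m) : curvature (connMap c) z v w M = 0 := by
  have h0 := (rowMap_zero_eq_zero_iff hc hO hz).1 (rowMap_eq_zero_of_succ h)
  have hz0 : ((z, 0, 0) : Jet m).1 ∈ O := hz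
  have hz1 : ((z, pq) : Jet m).1 ∈ O := hz
  refine curvature_eq_zero hc hO hz (fun p q α β => algHK_eq_zero hc hO hz h0 α β p q) ?_ ?_ v w
  · intro α β γ
    have := h0 (.s α β γ)
    simpa only [algRowValue, algS, S_rhs hc hO hz0, S_rhs hc hO hz1] using this
  · intro v α β γ
    have h1 := congrFun (covDeriv_eq_zero_of_rowMap_succ hc hO hz h v) (AlgRow.s α β γ)
    have h2 := hasFDerivAt_rowMap_apply (pq := pq) hc hO 0 hz M (AlgRow.s α β γ)
    have hd : ∀ σ β γ, HasFDerivAt (fun z' => c.C σ β γ z' - c.C σ γ β z')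
        (fderiv ℝ (c.C σ β γ) z - fderiv ℝ (c.C σ γ β) z) z := fun σ β γ =>
      (hc.differentiableAt_C hO hz σ β γ).hasFDerivAt.sub
        (hc.differentiableAt_C hO hz σ γ β).hasFDerivAt
    have h3 := (HasFDerivAt.fun_sum (u := Finset.univ) fun σ _ =>
      (hd σ β γ).const_mul (M s(α, σ))).fun_add (HasFDerivAt.fun_sum (u := Finset.univ) fun σ _ =>
      (hd σ α γ).const_mul (M s(β, σ)))
    have h4 := h3.congr_of_eventuallyEq (f₁ := fun z' => rowMap c 0 pq z' M (AlgRow.s α β γ)) (by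
      filter_upwards [hO.mem_nhds hz] with z' hz'
      exact rowMap_zero_s hc hO hz' M α β γ)
    have h5 : fderiv ℝ (rowMap c 0 pq) z v M (AlgRow.s α β γ) =
        ∑ σ, M s(α, σ) * dS c z v σ β γ + ∑ σ, M s(β, σ) * dS c z v σ α γ := by
      refine (congrArg (fun L => L v) (h2.unique h4)).trans ?_
      simp [dS]
    have h6 : fderiv ℝ (rowMap c 0 pq) z v M (AlgRow.s α β γ) +
      rowMap c 0 pq z (connMap c z v M) (AlgRow.s α β γ) = 0 := h1
    rw [h5, rowMap_zero_s hc hO hz] at h6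
    simp only [algS, S_rhs hc hO hz0]
    exact h6

end Rows

/-! ### Solutions as parallel sections of the stable kernel -/

section Solutions

theorem eventually_norm_lt_add_one {E F : Type*} [NormedAddCommGroup E] [NormedSpace ℝ E]
    [NormedAddCommGroup F] [NormedSpace ℝ F] {n : ℕ∞ω} {g : E → F} {z : E}
    (h : ContDiffAt ℝ n g z) : ∀ᶠ z' in 𝓝 z, ‖g z'‖ < ‖g z‖ + 1 :=
  h.continuousAt.norm.eventually (gt_mem_nhds (lt_add_one _))

theorem rowMap_one_of_rowMap_succ {pq : (Fin m → ℝ) × (Fin m → ℝ)} {k : ℕ} {z : Base m}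
    {M : Sym2 (Fin m) → ℝ} (h : rowMap c (k + 1) pq z M = 0) : rowMap c 1 pq z M = 0 := by
  induction k with
  | zero => exact h
  | succ k ih => exact ih (rowMap_eq_zero_of_succ h)

theorem hasFDerivAt_connMap_iff {M : Base m → Sym2 (Fin m) → ℝ} {z : Base m} :
    HasFDerivAt M ((connMap c z).flip (M z)) z ↔ ∀ α β : Fin m,
      HasFDerivAt (fun z' => M z' s(α, β)) (connForm c z (M z) α β) z := by
  have h : ∀ α β, (ContinuousLinearMap.proj (R := ℝ) (φ := fun _ : Sym2 (Fin m) => ℝ)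
      s(α, β)).comp ((connMap c z).flip (M z)) = connForm c z (M z) α β := fun α β =>
    ContinuousLinearMap.ext fun _ => rfl
  rw [hasFDerivAt_pi']
  refine ⟨fun hM α β => h α β ▸ hM s(α, β), fun hM e => ?_⟩
  induction e with | _ α β
  rw [h]
  exact hM α β

variable (hc : c.SmoothOn O) (hO : IsOpen O)
include hc hO

/-- Solutions of the algebraic and differential conditions lie in the kernels of all `Φ_k`. -/
theorem rowMap_eq_zero_of_solution {z₀ : Base m} {pq : (Fin m → ℝ) × (Fin m → ℝ)} {ρ : ℝ}
    (hρ : Metric.ball z₀ ρ ⊆ O) {M : Base m → Sym2 (Fin m) → ℝ}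
    (hM : ∀ z ∈ Metric.ball z₀ ρ, HasFDerivAt M ((connMap c z).flip (M z)) z)
    (hHK : ∀ z ∈ Metric.ball z₀ ρ, ∀ p ∈ Metric.ball pq ρ, ∀ α β,
      algHK (rhs c) (M z) α β (z, p) 0 0 = 0)
    (hS : ∀ z ∈ Metric.ball z₀ ρ, ∀ α β γ, algS (rhs c) (M z) α β γ (z, pq) = 0) (k : ℕ) :
    ∀ z ∈ Metric.ball z₀ ρ, rowMap c k pq z (M z) = 0 := by
  have hU := isOpen_fst_preimage (m := m) hO
  induction k with
  | zero =>
    intro z hz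
    have hpq : pq ∈ Metric.ball pq ρ := Metric.mem_ball_self (Metric.pos_of_mem_ball hz)
    have hsm := fun α β => contDiffOn_algHK hU (contDiffOn_rhs hc) (M z) α β 0 0
    -- The rows with fibre derivatives require vanishing on a neighbourhood of `pq` in the fibre,
    -- not only at `pq`.
    have hpd : ∀ {g : Jet m → ℝ}, ContDiffOn ℝ ∞ g {j | j.1 ∈ O} →
        (∀ p ∈ Metric.ball pq ρ, g (z, p) = 0) → ∀ w, ∀ p ∈ Metric.ball pq ρ,
        pd (0, w) g (z, p) = 0 := by
      intro g hg h0 w p hp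
      refine pd_eq_of_hasDerivAt ((hg.contDiffAt (hU.mem_nhds (hρ hz))).differentiableAt
        (by simp)) ?_
      refine (hasDerivAt_const (0 : ℝ) (0 : ℝ)).congr_of_eventuallyEq ?_
      have hcont : Continuous fun t : ℝ => p + t • w := by fun_prop
      have hev : ∀ᶠ t : ℝ in 𝓝 0, p + t • w ∈ Metric.ball pq ρ :=
        (hcont.tendsto 0).eventually (Metric.isOpen_ball.mem_nhds (by simpa using hp))
      filter_upwards [hev] with t ht
      have : ((z, p) : Jet m) + t • (0, w) = (z, p + t • w) := by simp
      rw [this, h0 _ ht]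
    refine (rowMap_zero_eq_zero_iff hc hO (hρ hz)).2 fun a => ?_
    cases a with
    | hk α β => exact hHK z hz pq hpq α β
    | hkP α β σ => exact hpd (hsm α β) (fun p hp => hHK z hz p hp α β) _ pq hpq
    | hkQ α β τ => exact hpd (hsm α β) (fun p hp => hHK z hz p hp α β) _ pq hpq
    | hkPQ α β σ τ =>
      exact hpd (contDiffOn_pd hU (hsm α β) _)
        (hpd (hsm α β) (fun p hp => hHK z hz p hp α β) _) _ pq hpq
    | s α β γ => exact hS z hz α β γ
  | succ k ih =>
    intro z hz
    refine rowMap_succ_eq_zero hc hO (hρ hz) (ih z hz) fun v => ?_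
    have h1 := (differentiableAt_rowMap (pq := pq) hc hO k (hρ hz)).hasFDerivAt.clm_apply (hM z hz)
    have h2 : HasFDerivAt (fun z' => rowMap c k pq z' (M z'))
        (0 : Base m →L[ℝ] (RowIdx m k → ℝ)) z := by
      refine (hasFDerivAt_const (0 : RowIdx m k → ℝ) z).congr_of_eventuallyEq ?_
      filter_upwards [Metric.isOpen_ball.mem_nhds hz] with z' hz'
      exact ih z' hz'
    have h3 := congrArg (fun L => L v) (h1.unique h2)
    have h4 : rowMap c k pq z (connMap c z v (M z)) + fderiv ℝ (rowMap c k pq) z v (M z) = 0 := h3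
    rwa [add_comm] at h4

/-- Every element of the kernel of a stable `Φ_k` extends to a flat section. -/
theorem exists_flat_section_of_rank_eq {pq : (Fin m → ℝ) × (Fin m → ℝ)} {k r : ℕ}
    {D : Set (Base m)} (hD : IsOpen D) (hDO : D ⊆ O)
    (h0 : ∀ z ∈ D, (Phi (rhs c) c k (z, pq)).rank = r)
    (h1 : ∀ z ∈ D, (Phi (rhs c) c (k + 1) (z, pq)).rank = r) {z₀ : Base m} (hz₀ : z₀ ∈ D) :
    ∃ ρ > 0, ∀ M₀, rowMap c k pq z₀ M₀ = 0 → ∃ M : Base m → Sym2 (Fin m) → ℝ, M z₀ = M₀ ∧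
      ∀ z ∈ Metric.ball z₀ ρ,
        HasFDerivAt M ((connMap c z).flip (M z)) z ∧ rowMap c k pq z (M z) = 0 := by
  obtain ⟨K, -, hK⟩ := eventually_norm_rowMap_succ_le hc hO hD hDO h0 h1 hz₀
  refine exists_flat_section (K := (2 + m) * K)
    ((hc.contDiffOn_connMap.contDiffAt (hO.mem_nhds (hDO hz₀))).of_le (m := 2)
      (show ((2 : ℕ∞) : ℕ∞ω) ≤ ∞ from WithTop.coe_le_coe.2 le_top)) ?_ ?_ ?_
  · filter_upwards [hO.mem_nhds (hDO hz₀)] with z hz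
    exact differentiableAt_rowMap hc hO k hz
  · filter_upwards [hO.mem_nhds (hDO hz₀), hK] with z hz hKz v M
    refine (norm_covDeriv_le hc hO k hz v M).trans ?_
    calc (2 + m) * ‖v‖ * ‖rowMap c (k + 1) pq z M‖
        ≤ (2 + m) * ‖v‖ * (K * ‖rowMap c k pq z M‖) := by
          gcongr
          exact hKz M
      _ = (2 + m) * K * ‖v‖ * ‖rowMap c k pq z M‖ := by ring
  -- Equality of ranks places `M` in `ker Φ_{k+1}`, hence in `ker Φ_1`, even when `k = 0`.
  · filter_upwards [hD.mem_nhds hz₀] with z hz M hM v w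
    exact curvature_eq_zero_of_rowMap_one hc hO (hDO hz) (rowMap_one_of_rowMap_succ
      (rowMap_succ_eq_zero_of_rank_eq ((h1 z hz).trans (h0 z hz).symm) hM)) v w

end Solutions

/-- Evaluation at `z₀` is an isomorphism onto `ker Φ_k`: injective by uniqueness along rays,
surjective by `exists_flat_section_of_rank_eq`. -/
theorem exists_nhds_finrank_solutionSpace {U : Set (Jet m)} (hU : IsOpen U)
    {f : Fin m → Jet m → ℝ} (hf : ∀ α, ContDiffOn ℝ ∞ (f α) U) (hc : HasNormalForm f c U)
    {V : Set (Jet m)} (hV : IsOpen V) (hVU : V ⊆ U) {r k : ℕ}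
    (h0 : ∀ j ∈ V, (Phi (rhs c) c k j).rank = r)
    (h1 : ∀ j ∈ V, (Phi (rhs c) c (k + 1) j).rank = r) {j₀ : Jet m} (hj₀ : j₀ ∈ V) :
    ∃ W : Set (Jet m), IsOpen W ∧ IsConnected W ∧ j₀ ∈ W ∧ W ⊆ V ∧
      FiniteDimensional ℝ (solutionSpace f c W) ∧
      Module.finrank ℝ (solutionSpace f c W) + r = m * (m + 1) / 2 := by
  obtain ⟨z₀, pq⟩ := j₀
  set O : Set (Base m) := Prod.fst '' U with hOdef
  have hO : IsOpen O := isOpenMap_fst U hU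
  have hs : c.SmoothOn O := hc.smoothOn hU hf
  have hD : IsOpen {z : Base m | (z, pq) ∈ V} :=
    hV.preimage (by fun_prop : Continuous fun z : Base m => (z, pq))
  have hDO : {z : Base m | (z, pq) ∈ V} ⊆ O := fun z hz => ⟨_, hVU hz, rfl⟩
  obtain ⟨ρ₁, hρ₁, hex⟩ := exists_flat_section_of_rank_eq hs hO hD hDO
    (fun z hz => h0 _ hz) (fun z hz => h1 _ hz) (show z₀ ∈ {z : Base m | (z, pq) ∈ V} from hj₀)
  obtain ⟨ρ₂, hρ₂, hballV⟩ := Metric.isOpen_iff.1 hV _ hj₀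
  have hAC : ∀ᶠ z in 𝓝 z₀, ‖connMap c z‖ < ‖connMap c z₀‖ + 1 := by
    exact eventually_norm_lt_add_one
      (hs.contDiffOn_connMap.contDiffAt (hO.mem_nhds (hDO hj₀)))
  obtain ⟨ρ₃, hρ₃, hbound⟩ := Metric.eventually_nhds_iff_ball.1 hAC
  obtain ⟨ρ, hρ, hρ1, hρ2, hρ3⟩ : ∃ ρ > 0, ρ ≤ ρ₁ ∧ ρ ≤ ρ₂ ∧ ρ ≤ ρ₃ :=
    ⟨min ρ₁ (min ρ₂ ρ₃), by positivity, min_le_left _ _,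
      (min_le_right _ _).trans (min_le_left _ _), (min_le_right _ _).trans (min_le_right _ _)⟩
  -- In the maximum norm this ball is a product: its projection is a ball, star-shaped about `z₀`,
  -- and `pq` is interior to each fibre.
  set W : Set (Jet m) := Metric.ball (z₀, pq) ρ with hW
  have hWV : W ⊆ V := (Metric.ball_subset_ball hρ2).trans hballV
  have hprod : W = Metric.ball z₀ ρ ×ˢ Metric.ball pq ρ := (ball_prod_same z₀ pq ρ).symm
  have hfst : Prod.fst '' W = Metric.ball z₀ ρ := by
    rw [hprod, Set.fst_image_prod _ ⟨pq, Metric.mem_ball_self hρ⟩]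
  have hpq : pq ∈ Metric.ball pq ρ := Metric.mem_ball_self hρ
  have hmem : ∀ z ∈ Metric.ball z₀ ρ, ∀ p ∈ Metric.ball pq ρ, (z, p) ∈ W := fun z hz p hp => by
    rw [hprod]
    exact ⟨hz, hp⟩
  have hz₀ : z₀ ∈ Metric.ball z₀ ρ := Metric.mem_ball_self hρ
  have hballO : Metric.ball z₀ ρ ⊆ O := fun z hz => hDO (hWV (hmem z hz pq hpq))
  have hfr : ∀ α, Set.EqOn (f α) (rhs c α) U := hc.eqOn_rhs
  have hflat : ∀ M ∈ solutionSpace f c W, ∀ z ∈ Metric.ball z₀ ρ,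
      HasFDerivAt M ((connMap c z).flip (M z)) z := fun M hM z hz =>
    hasFDerivAt_connMap_iff.2 (hM.1.diff z (hfst ▸ hz))
  let ev : solutionSpace f c W →ₗ[ℝ] LinearMap.ker (rowMap c k pq z₀).toLinearMap :=
    { toFun := fun M => ⟨M.1 z₀, rowMap_eq_zero_of_solution hs hO hballO (hflat M.1 M.2)
        (fun z hz p hp α β => by
          rw [← algHK_congr hU hfr _ _ _ (hVU (hWV (hmem z hz p hp)))]
          exact M.2.1.alg_HK _ (hmem z hz p hp) α β 0 0)
        (fun z hz α β γ => by
          rw [← algS_congr hU hfr _ _ _ _ (hVU (hWV (hmem z hz pq hpq)))]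
          exact M.2.1.alg_S _ (hmem z hz pq hpq) α β γ) k z₀ hz₀⟩
      map_add' := fun _ _ => rfl
      map_smul' := fun _ _ => rfl }
  have hinj : Function.Injective ev := by
    rw [← LinearMap.ker_eq_bot, LinearMap.ker_eq_bot']
    intro M hM
    have hM0 : M.1 z₀ = 0 := congrArg Subtype.val hM
    refine Subtype.ext (funext fun z => ?_)
    by_cases hz : z ∈ Metric.ball z₀ ρ
    · exact flat_section_eq_zero
        (fun z hz => (hbound z (Metric.ball_subset_ball hρ3 hz)).le) (hflat M.1 M.2) hM0 z hz
    · exact M.2.2 z (hfst ▸ hz)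
  have hsurj : Function.Surjective ev := by
    classical
    rintro ⟨M₀, hM₀⟩
    obtain ⟨M, hMz₀, hM⟩ := hex M₀ hM₀
    have hMρ := fun z (hz : z ∈ Metric.ball z₀ ρ) => hM z (Metric.ball_subset_ball hρ1 hz)
    -- Extension by zero is the normalization built into `solutionSpace`.
    let N : Base m → Sym2 (Fin m) → ℝ := fun z => if z ∈ Metric.ball z₀ ρ then M z else 0
    have hN : ∀ z ∈ Metric.ball z₀ ρ, N z = M z := fun z hz => if_pos hz
    have hNd : ∀ z ∈ Metric.ball z₀ ρ, HasFDerivAt N ((connMap c z).flip (N z)) z := by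
      intro z hz
      rw [hN z hz]
      refine (hMρ z hz).1.congr_of_eventuallyEq ?_
      filter_upwards [Metric.isOpen_ball.mem_nhds hz] with z' hz'
      exact hN z' hz'
    -- The constraints are known at `pq` only; `algHK_eq_zero'` and `S_rhs` carry them to the other
    -- jets of `W`.
    have hNalg : ∀ z ∈ Metric.ball z₀ ρ, ∀ a, algRowValue (rhs c) (N z) a (z, pq) = 0 := by
      intro z hz
      rw [hN z hz]
      exact (rowMap_zero_eq_zero_iff hs hO (hballO hz)).1 (rowMap_zero_of_rowMap (hMρ z hz).2)
    have hjz : ∀ j ∈ W, j.1 ∈ Metric.ball z₀ ρ := fun j hj => hfst ▸ ⟨j, hj, rfl⟩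
    have hNsol : N ∈ solutionSpace f c W := by
      refine ⟨⟨?_, ?_, ?_, ?_⟩, ?_⟩
      · rw [hfst]
        exact contDiffOn_of_hasFDerivAt_flat Metric.isOpen_ball
          (hs.contDiffOn_connMap.mono hballO) hNd
      · intro j hj α β a b
        rw [algHK_congr hU hfr _ _ _ (hVU (hWV hj))]
        exact algHK_eq_zero' hs hO (hballO (hjz j hj)) (hNalg _ (hjz j hj)) α β j.2.1 j.2.2 a b
      · intro j hj α β γ
        rw [algS_congr hU hfr _ _ _ _ (hVU (hWV hj))]
        have h := hNalg _ (hjz j hj) (.s α β γ)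
        have e1 : j.1 ∈ O := hballO (hjz j hj)
        have e2 : ((j.1, pq) : Jet m).1 ∈ O := e1
        simpa only [algRowValue, algS, S_rhs hs hO e1, S_rhs hs hO e2] using h
      · intro z hz
        exact hasFDerivAt_connMap_iff.1 (hNd z (hfst ▸ hz))
      · intro z hz
        exact if_neg (hfst ▸ hz)
    refine ⟨⟨N, hNsol⟩, Subtype.ext ?_⟩
    exact (hN z₀ hz₀).trans hMz₀
  let e := LinearEquiv.ofBijective ev ⟨hinj, hsurj⟩
  refine ⟨W, Metric.isOpen_ball, (convex_ball _ _).isConnected ⟨_, Metric.mem_ball_self hρ⟩,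
    Metric.mem_ball_self hρ, hWV, Module.Finite.equiv e.symm, ?_⟩
  rw [e.finrank_eq, ← h0 _ hj₀]
  exact finrank_ker_rowMap k z₀

end VarMult

end

/-! ### The main theorem -/

theorem theorem2p4 (m : ℕ) (U : Set (VarMult.Jet m)) (hU : IsOpen U)
    (f : Fin m → VarMult.Jet m → ℝ) (hf : ∀ α, ContDiffOn ℝ ∞ (f α) U)
    (c : VarMult.Coeffs m) (hc : VarMult.HasNormalForm f c U) :
    (∀ k : ℕ, ∀ z ∈ U,
      (VarMult.Phi f c k z).rank ≤ (VarMult.Phi f c (k + 1) z).rank ∧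
      (VarMult.Phi f c k z).rank ≤ m * (m + 1) / 2) ∧
    ∀ (V : Set (VarMult.Jet m)), IsOpen V → V ⊆ U → ∀ r k : ℕ,
      (∀ z ∈ V, (VarMult.Phi f c k z).rank = r) →
      (m * (m + 1) / 2 ≤ k ∨ ∀ z ∈ V, (VarMult.Phi f c (k + 1) z).rank = r) →
      (∀ i : ℕ, ∀ z ∈ V, (VarMult.Phi f c (k + i) z).rank = r) ∧
      ∀ z₀ ∈ V, ∃ W : Set (VarMult.Jet m), IsOpen W ∧ IsConnected W ∧ z₀ ∈ W ∧ W ⊆ V ∧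
        FiniteDimensional ℝ (VarMult.solutionSpace f c W) ∧
        Module.finrank ℝ (VarMult.solutionSpace f c W) + r = m * (m + 1) / 2 := by
  refine ⟨fun k z _ => ⟨VarMult.rank_Phi_le_succ f c k z, VarMult.rank_Phi_le f c k z⟩, ?_⟩
  intro V hV hVU r k hr hk
  have hO : IsOpen (Prod.fst '' U) := isOpenMap_fst U hU
  have hs : c.SmoothOn (Prod.fst '' U) := hc.smoothOn hU hf
  have hΦ : ∀ k, ∀ j ∈ U, VarMult.Phi f c k j = VarMult.Phi (VarMult.rhs c) c k j :=
    fun k j hj => Matrix.ext fun a e => VarMult.Phi_congr hU hc.eqOn_rhs c k a e hj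
  -- The rank argument runs separately in each slice of `V` with fixed `(u_x, u_y)`, an open set of
  -- base points.
  have hopen : ∀ pq : (Fin m → ℝ) × (Fin m → ℝ), IsOpen {z : VarMult.Base m | (z, pq) ∈ V} :=
    fun pq => hV.preimage (by fun_prop : Continuous fun z : VarMult.Base m => (z, pq))
  have hsub : ∀ pq : (Fin m → ℝ) × (Fin m → ℝ),
      {z : VarMult.Base m | (z, pq) ∈ V} ⊆ Prod.fst '' U := fun pq z hz => ⟨_, hVU hz, rfl⟩
  have hstab : ∀ pq : (Fin m → ℝ) × (Fin m → ℝ), ∀ D' ⊆ {z : VarMult.Base m | (z, pq) ∈ V},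
      IsOpen D' → ∀ k r, (∀ z ∈ D', (VarMult.Phi (VarMult.rhs c) c k (z, pq)).rank = r) →
      (∀ z ∈ D', (VarMult.Phi (VarMult.rhs c) c (k + 1) (z, pq)).rank = r) →
      ∀ z ∈ D', (VarMult.Phi (VarMult.rhs c) c (k + 2) (z, pq)).rank = r :=
    fun pq D' hD' ho k r h0 h1 =>
      VarMult.rank_Phi_add_two hs hO ho (hD'.trans (hsub pq)) h0 h1
  have h0 : ∀ j ∈ V, (VarMult.Phi (VarMult.rhs c) c k j).rank = r := fun j hj => by
    rw [← hΦ k j (hVU hj), hr j hj]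
  have h1 : ∀ j ∈ V, (VarMult.Phi (VarMult.rhs c) c (k + 1) j).rank = r := by
    rcases hk with hk | hk
    · rintro ⟨z, pq⟩ hj
      exact VarMult.rank_succ_eq_of_le
        (ρ := fun k z => (VarMult.Phi (VarMult.rhs c) c k (z, pq)).rank) (hopen pq)
        (fun k z _ => VarMult.rank_Phi_le _ _ _ _) (fun k z _ => VarMult.rank_Phi_le_succ _ _ _ _)
        (fun k z hz => VarMult.eventually_rank_Phi_le hs hO k (hsub pq hz)) (hstab pq) hk
        (fun z hz => h0 _ hz) z hj
    · exact fun j hj => by rw [← hΦ _ j (hVU hj), hk j hj]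
  refine ⟨?_, fun z₀ hz₀ =>
    VarMult.exists_nhds_finrank_solutionSpace hU hf hc hV hVU h0 h1 hz₀⟩
  rintro i ⟨z, pq⟩ hj
  rw [hΦ _ _ (hVU hj)]
  exact VarMult.rank_stable
    (ρ := fun k z => (VarMult.Phi (VarMult.rhs c) c k (z, pq)).rank) (hstab pq) subset_rfl
    (hopen pq) (fun z hz => h0 _ hz) (fun z hz => h1 _ hz) i z hj
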